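/- Let $\mu>0$, $\mu\neq 1$. Let $\mathbb R^4_1$ be $\mathbb R^4$ with $\langle x,y\rangle=-x_0y_0+x_1y_1+x_2y_2+x_3y_3$ and $S^3_1=\{x:\langle x,x\rangle=1\}$ the de Sitter 3-space. Put $$x_1(\theta)=-\tfrac{(\mu^2+1)\cos\theta\cos\mu\theta}{2\mu}-\sin\theta\sin\mu\theta,\qquad x_2(\theta)=-\tfrac{(\mu^2+1)\sin\theta\cos\mu\theta}{2\mu}+\cos\theta\sin\mu\theta,\qquad p(\theta)=-\tfrac{\mu^2-1}{2\mu}\cos\mu\theta,$$ let $f:\mathbb R^2\to S^3_1$, $f(s,\theta)=(p(\theta)\cosh s,\,x_1(\theta),\,x_2(\theta),\,p(\theta)\sinh s)$ be the G-catenoid of type SE, and let $$\mathcal X=\Big\{(\xi,\eta,\theta)\in\mathbb R^3:\ \xi\eta=\Big(\tfrac{(\mu^2-1)\cos\mu\theta}{2\mu}\Big)^2\Big\},\qquad \tilde f:\mathcal X\to S^3_1,\quad \tilde f(\xi,\eta,\theta)=\Big(\tfrac{\xi+\eta}2,\,x_1(\theta),\,x_2(\theta),\,\tfrac{\xi-\eta}2\Big),$$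 $$\mathcal L=\bigcup_{k\in\mathbb Z}\{(u,x_1(\theta_k),x_2(\theta_k),\pm u):u\in\mathbb R\},\quad \theta_k=\tfrac{\pi(2k+1)}{2\mu},\qquad R(x_0,x_1,x_2,x_3)=(-x_0,x_1,x_2,-x_3).$$ Terminology. The standard double cone is $\mathcal C=\{a\in\mathbb R^3:a_1^2+a_2^2=a_3^2\}$; a map on an open subset of $\mathcal C$ is real analytic if it is the restriction of a real analytic map on an open set of $\mathbb R^3$ whose trace on $\mathcal C$ is that subset. A $2$-dimensional real analytic DC-manifold is a locally compact, second countable Hausdorff space with an atlas of homeomorphisms onto connected open subsets of $\mathcal C$ with real analytic transition maps; the points mapped to the vertex $\mathbf 0$ are its DC-points. A map from a DC-manifold to a real analytic manifold is DC-analytic if it is real analytic in the charts, and so is a map from $\mathbb R^2$ to a DC-manifold. A DC-analytic map $h:X\to N$ to a real analytic $3$-manifold is a real analytic DC-immersion if near every point there are a DC-coordinate system $\phi$ on an open set $U\subset X$ and a real analytic diffeomorphism $\Phi$ from an open set of $N$ containing $h(U)$ onto an open set of $\mathbb R^3$ with $\Phi\circ h\circ\phi^{-1}(a)=a$ on $\phi(U)$.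 A real analytic DC-immersion $h:X\to S^3_1$ of a connected $X$ is space-like CMC-1 if each non-DC-point either is a point where the induced metric is positive definite and the mean curvature is $1$ for one of the two unit normals, or is a light-like point (the induced metric is degenerate and positive semidefinite), and the points of the first kind contain an open dense subset of $X$. A non-empty $S\subset S^3_1$ is analytically complete if every real analytic $\Gamma:[0,1]\to S^3_1$ with $\Gamma([0,\varepsilon))\subset S$ for some $\varepsilon\in(0,1)$ satisfies $\Gamma([0,1])\subset S$. A continuous map $h:X\to S^3_1$ is $C^0$-arc-proper if, for every continuous $\sigma:[0,1)\to X$ such that $h\circ\sigma$ extends continuously to $[0,1]$, there are $t_k\in[0,1)$ with $t_k\to1$ such that $\sigma(t_k)$ converges in $X$. Then: 1. $\mathcal X$ (with the topology of $\mathbb R^3$) has the structure of a $2$-dimensional real analytic DC-manifold for which the inclusion $\mathcal X\hookrightarrow\mathbb R^3$ is a real analytic DC-immersion and whose DC-points are exactly the points of $\mathcal X$ with $\xi=\eta=0$. With respect to it, $\tilde f$ is a real analytic space-like CMC-1 DC-immersion; it is space-like with mean curvature $1$ at every point of $\mathcal X\setminus\tilde f^{-1}(\mathcal L)$. 2. $\tilde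 f$ is an analytic extension of $f$: $f$ is real analytic, $f=\tilde f\circ\varphi$ for a DC-analytic map $\varphi:\mathbb R^2\to\mathcal X$, and $f(\mathbb R^2)$ is a proper subset of $\tilde f(\mathcal X)$. 3. $\tilde f(\mathcal X)=f(\mathbb R^2)\cup\mathcal L\cup R(f(\mathbb R^2))$. 4. $\tilde f$ is $C^0$-arc-proper, and $\tilde f(\mathcal X)$ is analytically complete in $S^3_1$. -/

import Mathlib

open Set Filter Topology

/-! ### Double-cone manifolds -/

/-- The `m`-dimensional standard double cone `x₁² + ⋯ + x_m² = x_{m+1}²` in `ℝ^{m+1}`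
(the last coordinate is the axis). -/
def DoubleCone (m : ℕ) : Set (Fin (m + 1) → ℝ) :=
  {x | ∑ j : Fin m, x j.castSucc ^ 2 = x (Fin.last m) ^ 2}

/-- A map `g` on an open subset `U` of the double cone is real analytic if `U` is the trace of an
open set `Ω` of the ambient space and `g` is the restriction of a real analytic map on `Ω`. -/
def ConeAnalyticOn {m : ℕ} {F : Type*} [NormedAddCommGroup F] [NormedSpace ℝ F]
    (U : Set (DoubleCone m)) (g : DoubleCone m → F) : Prop :=
  ∃ (Ω : Set (Fin (m + 1) → ℝ)) (G : (Fin (m + 1) → ℝ) → F),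
    IsOpen Ω ∧ (Subtype.val ⁻¹' Ω : Set (DoubleCone m)) = U ∧ AnalyticOnNhd ℝ G Ω ∧
      ∀ a ∈ U, G a.1 = g a

/-- A structure of an `m`-dimensional real analytic double-cone manifold on a topological space. -/
structure DCStructure (m : ℕ) (X : Type*) [TopologicalSpace X] where
  locallyCompact : LocallyCompactSpace X
  hausdorff : T2Space X
  secondCountable : SecondCountableTopology X
  /-- the DC-charts `φ : U → DoubleCone m`, homeomorphisms between open sets -/
  atlas : Set (OpenPartialHomeomorph X (DoubleCone m))
  cover : ∀ p : X, ∃ e ∈ atlas, p ∈ e.source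
  connected : ∀ e ∈ atlas, IsConnected e.target
  compatible : ∀ e ∈ atlas, ∀ e' ∈ atlas,
    ConeAnalyticOn (e.symm.trans e').source (fun a => (e' (e.symm a)).1)

namespace DCStructure

variable {m : ℕ} {X : Type*} [TopologicalSpace X] (D : DCStructure m X)

/-- Local DC-coordinate systems: charts that are analytically compatible with the atlas. -/
def IsCoord (e : OpenPartialHomeomorph X (DoubleCone m)) : Prop :=
  ∀ e' ∈ D.atlas,
    ConeAnalyticOn (e.symm.trans e').source (fun a => (e' (e.symm a)).1) ∧
    ConeAnalyticOn (e'.symm.trans e).source (fun a => (e (e'.symm a)).1)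

/-- The set of DC-points: the points that some local DC-coordinate system sends to the vertex. -/
def dcPoints : Set X :=
  {p | ∃ e, D.IsCoord e ∧ p ∈ e.source ∧ (e p).1 = 0}

end DCStructure

/-! ### Maps into an embedded analytic submanifold `N` of a normed space `E`

A map into `N` is real analytic exactly when it is real analytic as a map into `E`. -/

/-- `Φ` restricts to a real analytic diffeomorphism from the open subset `N ∩ W` of `N` onto the
open subset `Ω₀` of `G`, with inverse `Ψ`. -/
def IsAnalyticDiffeoOn {E G : Type*} [NormedAddCommGroup E] [NormedSpace ℝ E]
    [NormedAddCommGroup G] [NormedSpace ℝ G]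
    (N W : Set E) (Ω₀ : Set G) (Φ : E → G) (Ψ : G → E) : Prop :=
  IsOpen W ∧ IsOpen Ω₀ ∧ AnalyticOnNhd ℝ Φ W ∧ AnalyticOnNhd ℝ Ψ Ω₀ ∧
    MapsTo Φ (N ∩ W) Ω₀ ∧ MapsTo Ψ Ω₀ (N ∩ W) ∧ InvOn Ψ Φ (N ∩ W) Ω₀

/-- A non-empty set `S ⊆ N` is analytically complete in `N` if every real analytic curve
`Γ : [0,1] → N` with `Γ([0,ε)) ⊆ S` for some `ε ∈ (0,1)` satisfies `Γ([0,1]) ⊆ S`. -/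
def AnalyticallyComplete {E : Type*} [NormedAddCommGroup E] [NormedSpace ℝ E]
    (N S : Set E) : Prop :=
  S.Nonempty ∧ S ⊆ N ∧
    ∀ Γ : ℝ → E, AnalyticOn ℝ Γ (Icc 0 1) → MapsTo Γ (Icc 0 1) N →
      (∃ ε ∈ Ioo (0 : ℝ) 1, MapsTo Γ (Ico 0 ε) S) → MapsTo Γ (Icc 0 1) S

/-- `C^r`-arc-properness of a map `f : X → N` (`r = 0`: continuous, `r = ∞`: smooth,
`r = ω`: real analytic). -/
def ArcProper {X E : Type*} [TopologicalSpace X] [NormedAddCommGroup E] [NormedSpace ℝ E]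
    (r : WithTop ℕ∞) (N : Set E) (f : X → E) : Prop :=
  Continuous f ∧ (∀ p, f p ∈ N) ∧
    ∀ σ : ℝ → X, ContinuousOn σ (Ico 0 1) →
      (∃ Γ : ℝ → E, ContDiffOn ℝ r Γ (Icc 0 1) ∧ MapsTo Γ (Icc 0 1) N ∧
        ∀ t ∈ Ico (0 : ℝ) 1, Γ t = f (σ t)) →
      ∃ (t : ℕ → ℝ) (q : X), (∀ k, t k ∈ Ico (0 : ℝ) 1) ∧ Tendsto t atTop (𝓝 1) ∧
        Tendsto (fun k => σ (t k)) atTop (𝓝 q)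

namespace DCStructure

variable {m : ℕ} {X : Type*} [TopologicalSpace X] (D : DCStructure m X)
  {E : Type*} [NormedAddCommGroup E] [NormedSpace ℝ E]

/-- DC-analytic maps from a DC-manifold to `N`. -/
def IsDCAnalytic (N : Set E) (f : X → E) : Prop :=
  (∀ p, f p ∈ N) ∧ ∀ e ∈ D.atlas, ConeAnalyticOn e.target (fun a => f (e.symm a))

/-- DC-regular points of a map into `N`, where `dim N = m + 1 + k`: in suitable coordinates of the
source and the target the map is the inclusion `a ↦ (a, 0)` of the double cone. -/
def IsDCRegularAt (k : ℕ) (N : Set E) (f : X → E) (p : X) : Prop :=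
  ∃ e : OpenPartialHomeomorph X (DoubleCone m), D.IsCoord e ∧ p ∈ e.source ∧
    ∃ (W : Set E) (Ω₀ : Set ((Fin (m + 1) → ℝ) × (Fin k → ℝ)))
      (Φ : E → (Fin (m + 1) → ℝ) × (Fin k → ℝ)) (Ψ : (Fin (m + 1) → ℝ) × (Fin k → ℝ) → E),
      IsAnalyticDiffeoOn N W Ω₀ Φ Ψ ∧ ∀ q ∈ e.source, f q ∈ W ∧ Φ (f q) = ((e q).1, 0)

/-- Real analytic DC-immersions into `N`, where `dim N = m + 1 + k`. -/
def IsDCImmersion (k : ℕ) (N : Set E) (f : X → E) : Prop :=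
  D.IsDCAnalytic N f ∧ ∀ p, D.IsDCRegularAt k N f p

/-- DC-analytic maps from an ordinary manifold, here a normed space `M`, to a DC-manifold. -/
def IsDCAnalyticFrom {M : Type*} [NormedAddCommGroup M] [NormedSpace ℝ M] (φ : M → X) : Prop :=
  Continuous φ ∧ ∀ e ∈ D.atlas, AnalyticOnNhd ℝ (fun v => (e (φ v)).1) (φ ⁻¹' e.source)

/-- The DC-analytic map `f₂ : X → N` is an analytic extension of the analytic map `f₁ : M → N`:
`f₁` factors through `f₂` by a DC-analytic map, and its image is a proper subset of
the image of `f₂`. -/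
def IsAnalyticExtension {M : Type*} [NormedAddCommGroup M] [NormedSpace ℝ M]
    (N : Set E) (f₁ : M → E) (f₂ : X → E) : Prop :=
  AnalyticOnNhd ℝ f₁ univ ∧ (∀ v, f₁ v ∈ N) ∧ D.IsDCAnalytic N f₂ ∧
    (∃ φ : M → X, D.IsDCAnalyticFrom φ ∧ f₁ = f₂ ∘ φ) ∧ range f₁ ⊂ range f₂

end DCStructure

/-! ### Space-like surfaces of constant mean curvature one in de Sitter 3-space -/

/-- The Lorentz-Minkowski inner product of signature `(-,+,+,+)`. -/
def minkowski (x y : Fin 4 → ℝ) : ℝ :=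
  -(x 0 * y 0) + x 1 * y 1 + x 2 * y 2 + x 3 * y 3

/-- The de Sitter 3-space. -/
def deSitter : Set (Fin 4 → ℝ) := {x | minkowski x x = 1}

section Surface

variable (F : ℝ × ℝ → Fin 4 → ℝ) (v : ℝ × ℝ)

/-- First fundamental form of `F` at `v`. -/
noncomputable def firstForm (a b : ℝ × ℝ) : ℝ :=
  minkowski (fderiv ℝ F v a) (fderiv ℝ F v b)

/-- `F` is a space-like immersion at `v`: the induced metric is positive definite. -/
def SpacelikeAt : Prop := ∀ a : ℝ × ℝ, a ≠ 0 → 0 < firstForm F v a a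

/-- `v` is a light-like point of `F`: the induced metric is degenerate and positive
semidefinite. -/
def LightlikeAt : Prop :=
  (∀ a : ℝ × ℝ, 0 ≤ firstForm F v a a) ∧ ∃ a : ℝ × ℝ, a ≠ 0 ∧ firstForm F v a a = 0

/-- Second fundamental form of `F` at `v` with respect to the normal `ν`. -/
noncomputable def secondForm (ν : Fin 4 → ℝ) (a b : ℝ × ℝ) : ℝ :=
  minkowski (fderiv ℝ (fun w => fderiv ℝ F w b) v a) ν

/-- The mean curvature (half the trace of the second fundamental form `h` with respect to
the first fundamental form `g`) with respect to the normal `ν`. -/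
noncomputable def meanCurvature (ν : Fin 4 → ℝ) : ℝ :=
  let g := firstForm F v
  let h := secondForm F v ν
  (g (1, 0) (1, 0) * h (0, 1) (0, 1) - 2 * g (1, 0) (0, 1) * h (1, 0) (0, 1)
      + g (0, 1) (0, 1) * h (1, 0) (1, 0)) /
    (2 * (g (1, 0) (1, 0) * g (0, 1) (0, 1) - g (1, 0) (0, 1) ^ 2))

/-- `ν` is a (time-like) unit normal in de Sitter 3-space of the surface `F` at `v`. -/
def IsUnitNormal (ν : Fin 4 → ℝ) : Prop :=
  minkowski ν ν = -1 ∧ minkowski ν (F v) = 0 ∧ ∀ a : ℝ × ℝ, minkowski ν (fderiv ℝ F v a) = 0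

/-- `F` is a space-like immersion at `v` and has mean curvature one there (for one of the two
choices of the unit normal). -/
def SpacelikeCMC1At : Prop :=
  SpacelikeAt F v ∧ ∃ ν, IsUnitNormal F v ν ∧ meanCurvature F v ν = 1

end Surface

namespace DCStructure

variable {X : Type*} [TopologicalSpace X] (D : DCStructure 2 X)

/-- Regular local parametrizations by open sets of `ℝ²` of the analytic surface that consists of
the non-DC-points: homeomorphisms onto open subsets that are analytic immersions into the cone
without its vertex when written in DC-charts. -/
def IsLocalParam (g : OpenPartialHomeomorph (ℝ × ℝ) X) : Prop :=
  ∀ e ∈ D.atlas, ∀ v ∈ g.source, g v ∈ e.source →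
    (e (g v)).1 ≠ 0 ∧ AnalyticAt ℝ (fun w => (e (g w)).1) v ∧
      Function.Injective (fderiv ℝ (fun w => (e (g w)).1) v)

/-- The map `f` is a space-like immersion with mean curvature one at the non-DC-point `p`. -/
def IsSpacelikeCMC1At (f : X → Fin 4 → ℝ) (p : X) : Prop :=
  ∃ g : OpenPartialHomeomorph (ℝ × ℝ) X, D.IsLocalParam g ∧
    ∃ v ∈ g.source, g v = p ∧ SpacelikeCMC1At (fun w => f (g w)) v

/-- The non-DC-point `p` is a light-like point of `f`. -/
def IsLightlikeAt (f : X → Fin 4 → ℝ) (p : X) : Prop :=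
  ∃ g : OpenPartialHomeomorph (ℝ × ℝ) X, D.IsLocalParam g ∧
    ∃ v ∈ g.source, g v = p ∧ LightlikeAt (fun w => f (g w)) v

/-- Real analytic space-like CMC-1 DC-immersions into de Sitter 3-space: DC-immersions of a
connected 2-dimensional DC-manifold for which every non-DC-point is either a point where the map
is space-like with mean curvature one or a light-like point, the former on an open dense set. -/
def IsSpacelikeCMC1DCImmersion (f : X → Fin 4 → ℝ) : Prop :=
  ConnectedSpace X ∧ D.IsDCImmersion 0 deSitter f ∧
    (∀ p ∉ D.dcPoints, D.IsSpacelikeCMC1At f p ∨ D.IsLightlikeAt f p) ∧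
    ∃ O : Set X, IsOpen O ∧ Dense O ∧ ∀ p ∈ O, D.IsSpacelikeCMC1At f p

end DCStructure

/-! ### The catenoids of type SE -/

/-- First coordinate function of the plane curve. -/
noncomputable def seX1 (μ θ : ℝ) : ℝ :=
  -((μ ^ 2 + 1) * Real.cos θ * Real.cos (μ * θ)) / (2 * μ) - Real.sin θ * Real.sin (μ * θ)

/-- Second coordinate function of the plane curve. -/
noncomputable def seX2 (μ θ : ℝ) : ℝ :=
  -((μ ^ 2 + 1) * Real.sin θ * Real.cos (μ * θ)) / (2 * μ) + Real.cos θ * Real.sin (μ * θ)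

/-- The G-catenoid of type SE, `(s, θ) ↦ B(s) (p(θ), x₁(θ), x₂(θ), 0)`, where `B(s)` is the boost
in the `(x₀, x₃)`-plane and `p(θ) = -(μ² - 1) cos(μθ) / (2μ)`. -/
noncomputable def seCatenoid (μ : ℝ) (w : ℝ × ℝ) : Fin 4 → ℝ :=
  ![Real.cosh w.1 * (-((μ ^ 2 - 1) / (2 * μ)) * Real.cos (μ * w.2)), seX1 μ w.2, seX2 μ w.2,
    Real.sinh w.1 * (-((μ ^ 2 - 1) / (2 * μ)) * Real.cos (μ * w.2))]

/-- The surface `ξη = ((μ² - 1) cos(μθ) / (2μ))²` in the space of `(ξ, η, θ)`. -/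
def seSurface (μ : ℝ) : Set (Fin 3 → ℝ) :=
  {p | p 0 * p 1 = ((μ ^ 2 - 1) * Real.cos (μ * p 2) / (2 * μ)) ^ 2}

/-- The map `(ξ, η, θ) ↦ ((ξ + η)/2, x₁(θ), x₂(θ), (ξ - η)/2)` on the surface. -/
noncomputable def seExtension (μ : ℝ) (p : seSurface μ) : Fin 4 → ℝ :=
  ![(p.1 0 + p.1 1) / 2, seX1 μ (p.1 2), seX2 μ (p.1 2), (p.1 0 - p.1 1) / 2]

/-- The limit point set of the catenoid: the union over `k ∈ ℤ` of the pairs of light-like lines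
`(u, x₁(θ_k), x₂(θ_k), ±u)`, `u ∈ ℝ`, where `θ_k = π(2k + 1)/(2μ)`. -/
def seLimitSet (μ : ℝ) : Set (Fin 4 → ℝ) :=
  {x | ∃ (k : ℤ) (u : ℝ),
    x = ![u, seX1 μ (Real.pi / (2 * μ) * (2 * k + 1)), seX2 μ (Real.pi / (2 * μ) * (2 * k + 1)), u]
    ∨ x = ![u, seX1 μ (Real.pi / (2 * μ) * (2 * k + 1)),
        seX2 μ (Real.pi / (2 * μ) * (2 * k + 1)), -u]}

/-- The isometry `diag(-1, 1, 1, -1)` of de Sitter 3-space. -/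
def seReflection (x : Fin 4 → ℝ) : Fin 4 → ℝ := ![-x 0, x 1, x 2, -x 3]

/-! ### Coordinates on the double cone and on the surface -/

/-! Write c = (μ² - 1)/(2μ), γ = (x₁, x₂), ξ = x₀ + x₃, η = x₀ - x₃. De Sitter space is x₁² + x₂² =
1 + ξη, and the plane curve satisfies |γ(θ)|² = 1 + c² cos²(μθ) (`seX1_sq_add_seX2_sq`). Hence the
extension lands in de Sitter space, and a point of that space is in the image exactly when (x₁, x₂)
lies on γ (`mem_range_seExtension_iff`).

DC-structure. Near θ_k the surface is ξη = c² sin²(μ(θ - θ_k)). The half-angle variable t = tan(μ(θ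
- θ_k)/2) makes this rational, and a rescaling of ξ, η turns it into the whole cone (`seChart`). An
analytic coordinate change of the cone fixes the vertex (`eq_zero_of_doubleCone_leftInverse`), so
the DC-points are ξ = η = 0.

Immersion and curvature. Since γ and γ' are independent (`seX_wedge_ne_zero`), (θ, ρ) ↦ ργ(θ) is a
local diffeomorphism at ρ = 1, and (ξ, η, θ) becomes a local coordinate system of de Sitter space
extending the map (`isDCImmersion_seExtension`). At regular points (ξ, θ) or (η, θ) are parameters.
The metric, degenerate only where cos(μθ) = 0, an explicit normal and the second fundamental form
give mean curvature one (`spacelikeCMC1At_seNull`).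

Image. Where cos(μθ) ≠ 0, ξη = p² ≠ 0, so (ξ, η) = ±p(eˢ, e⁻ˢ): the catenoid or its reflection.
Where cos(μθ) = 0, ξη = 0 gives the two light-like lines.

Properness and completeness. Convergence in de Sitter space controls ξ, η and hence cos²(μθ); a
continuous θ cannot escape to infinity while cos²(μθ) converges
(`exists_tendsto_of_tendsto_cos_sq`). For completeness, the polar angle of γ is an analytic
diffeomorphism of ℝ (`exists_inverse_sePolarAngle`). An analytic planar curve avoiding the origin
has an analytic argument, so each choice of branch 2πn gives a candidate lift. Uncountably many
parameters share one n, and the identity theorem makes that lift valid throughout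
(`exists_lift_seX`). The origin is never reached because |γ| ≥ 1, and the endpoint is handled as in
arc-properness. -/

theorem mem_doubleCone_two {a : Fin 3 → ℝ} :
    a ∈ DoubleCone 2 ↔ a 0 ^ 2 + a 1 ^ 2 = a 2 ^ 2 := by
  simp only [DoubleCone, mem_ofPred_eq, Fin.sum_univ_two]
  rfl

theorem isClosed_seSurface (μ : ℝ) : IsClosed (seSurface μ) := by
  unfold seSurface
  exact isClosed_eq (by fun_prop) (by fun_prop)

/-- The constant `(μ² - 1)/(2μ)`. -/
noncomputable def seConst (μ : ℝ) : ℝ := (μ ^ 2 - 1) / (2 * μ)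

theorem seConst_ne_zero {μ : ℝ} (hμ : 0 < μ) (hμ1 : μ ≠ 1) : seConst μ ≠ 0 := by
  unfold seConst
  refine div_ne_zero (fun h => hμ1 ?_) (by positivity)
  have : (μ - 1) * (μ + 1) = 0 := by linarith
  rcases mul_eq_zero.1 this with h | h <;> linarith

theorem mem_seSurface {μ : ℝ} {p : Fin 3 → ℝ} :
    p ∈ seSurface μ ↔ p 0 * p 1 = (seConst μ * Real.cos (μ * p 2)) ^ 2 := by
  unfold seSurface seConst
  rw [mem_ofPred_eq, mul_div_right_comm]

/-- The zeros `θ_k` of `cos (μθ)`. -/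
noncomputable def seAngle (μ : ℝ) (k : ℤ) : ℝ := Real.pi / (2 * μ) * (2 * k + 1)

theorem mul_seAngle {μ : ℝ} (hμ : 0 < μ) (k : ℤ) :
    μ * seAngle μ k = (2 * k + 1) * Real.pi / 2 := by
  unfold seAngle
  field_simp

theorem cos_mul_eq_zero_iff {μ : ℝ} (hμ : 0 < μ) {θ : ℝ} :
    Real.cos (μ * θ) = 0 ↔ ∃ k : ℤ, θ = seAngle μ k := by
  rw [Real.cos_eq_zero_iff]
  refine exists_congr fun k => ?_
  rw [← mul_seAngle hμ, mul_right_inj' hμ.ne']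

/-- Shifting by an odd multiple of π/2 exchanges cosine and sine up to a sign, which the square
removes. -/
theorem cos_sq_seAngle_add {μ : ℝ} (hμ : 0 < μ) (k : ℤ) (θ : ℝ) :
    Real.cos (μ * θ) ^ 2 = Real.sin (μ * (θ - seAngle μ k)) ^ 2 := by
  have h : μ * θ = μ * (θ - seAngle μ k) + μ * seAngle μ k := by ring
  have h0 : Real.cos (μ * seAngle μ k) = 0 := (cos_mul_eq_zero_iff hμ).2 ⟨k, rfl⟩
  have h1 := Real.sin_sq_add_cos_sq (μ * seAngle μ k)
  rw [h, Real.cos_add, h0]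
  rw [h0] at h1
  linear_combination Real.sin (μ * (θ - seAngle μ k)) ^ 2 * h1

/-- The coordinate change that maps the surface near `θ = θ_k` into the cone. -/
noncomputable def seChartFun (μ : ℝ) (k : ℤ) (p : Fin 3 → ℝ) : Fin 3 → ℝ :=
  ![(1 + Real.tan (μ * (p 2 - seAngle μ k) / 2) ^ 2) / (2 * seConst μ) * ((p 0 - p 1) / 2),
    Real.tan (μ * (p 2 - seAngle μ k) / 2),
    (1 + Real.tan (μ * (p 2 - seAngle μ k) / 2) ^ 2) / (2 * seConst μ) * ((p 0 + p 1) / 2)]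

/-- The inverse of `seChartFun`. -/
noncomputable def seChartInv (μ : ℝ) (k : ℤ) (a : Fin 3 → ℝ) : Fin 3 → ℝ :=
  ![2 * seConst μ * (a 2 + a 0) / (1 + a 1 ^ 2), 2 * seConst μ * (a 2 - a 0) / (1 + a 1 ^ 2),
    seAngle μ k + 2 / μ * Real.arctan (a 1)]

/-- The slab on which `seChartFun` is a diffeomorphism. -/
def seSlab (μ : ℝ) (k : ℤ) : Set (Fin 3 → ℝ) := {p | |μ * (p 2 - seAngle μ k)| < Real.pi}

theorem isOpen_seSlab (μ : ℝ) (k : ℤ) : IsOpen (seSlab μ k) := by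
  unfold seSlab
  exact isOpen_lt (by fun_prop) (by fun_prop)

theorem sin_eq_tan_half {x : ℝ} (h : Real.cos (x / 2) ≠ 0) :
    Real.sin x * (1 + Real.tan (x / 2) ^ 2) = 2 * Real.tan (x / 2) := by
  have h1 : Real.sin x = 2 * Real.sin (x / 2) * Real.cos (x / 2) := by
    rw [← Real.sin_two_mul]; ring_nf
  have h2 := Real.sin_sq_add_cos_sq (x / 2)
  rw [h1, Real.tan_eq_sin_div_cos]
  field_simp
  linear_combination Real.sin (x / 2) * h2

/-- If cos(x/2) = 0, then `Real.tan` is 0 there by convention and sin x = 0 too. So no restriction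
to the slab is needed, and `seChartFun` maps every point of the surface to the cone, as the total
function in `seChart` requires. -/
theorem sq_sin_mul_tan_half (x : ℝ) :
    (Real.sin x * (1 + Real.tan (x / 2) ^ 2)) ^ 2 = (2 * Real.tan (x / 2)) ^ 2 := by
  by_cases h : Real.cos (x / 2) = 0
  · have h1 : Real.sin x = 2 * Real.sin (x / 2) * Real.cos (x / 2) := by
      rw [← Real.sin_two_mul]; ring_nf
    rw [h1, Real.tan_eq_sin_div_cos, h]
    simp
  · rw [sin_eq_tan_half h]

theorem cos_half_pos_of_mem_seSlab {μ : ℝ} {k : ℤ} {p : Fin 3 → ℝ} (hp : p ∈ seSlab μ k) :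
    0 < Real.cos (μ * (p 2 - seAngle μ k) / 2) := by
  have h := abs_lt.1 (show |μ * (p 2 - seAngle μ k)| < Real.pi from hp)
  exact Real.cos_pos_of_mem_Ioo ⟨by linarith [h.1], by linarith [h.2]⟩

theorem exists_abs_mul_sub_seAngle_lt {μ : ℝ} (hμ : 0 < μ) (θ : ℝ) :
    ∃ k : ℤ, |μ * (θ - seAngle μ k)| < Real.pi := by
  -- Since μθ_k = kπ + π/2, this k puts μ(θ - θ_k) in [-π/2, π/2).
  refine ⟨⌊μ * θ / Real.pi⌋, ?_⟩
  have hpi := Real.pi_pos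
  have h1 := Int.floor_le (μ * θ / Real.pi)
  have h2 := Int.lt_floor_add_one (μ * θ / Real.pi)
  rw [le_div_iff₀ hpi] at h1
  rw [div_lt_iff₀ hpi] at h2
  rw [mul_sub, mul_seAngle hμ, abs_lt]
  constructor <;> linarith

/-- With t the half-angle tangent, ξη = (2ct/(1 + t²))². The factor (1 + t²)/(2c) cancels exactly
this denominator, leaving a₂² - a₀² = t² = a₁². -/
theorem seChartFun_mem {μ : ℝ} (hμ : 0 < μ) (hμ1 : μ ≠ 1) (k : ℤ) {p : Fin 3 → ℝ}
    (hp : p ∈ seSurface μ) : seChartFun μ k p ∈ DoubleCone 2 := by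
  have hc := seConst_ne_zero hμ hμ1
  rw [mem_seSurface, mul_pow, cos_sq_seAngle_add hμ k] at hp
  have h := sq_sin_mul_tan_half (μ * (p 2 - seAngle μ k))
  rw [mem_doubleCone_two]
  simp only [seChartFun, Matrix.cons_val]
  set t := Real.tan (μ * (p 2 - seAngle μ k) / 2)
  set s := Real.sin (μ * (p 2 - seAngle μ k))
  field_simp
  linear_combination (-4 * (1 + t ^ 2) ^ 2) * hp - 4 * seConst μ ^ 2 * h

theorem seChartInv_mem_slab {μ : ℝ} (hμ : 0 < μ) (k : ℤ) (a : Fin 3 → ℝ) :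
    seChartInv μ k a ∈ seSlab μ k := by
  have h1 := Real.neg_pi_div_two_lt_arctan (a 1)
  have h2 := Real.arctan_lt_pi_div_two (a 1)
  have h : μ * (seAngle μ k + 2 / μ * Real.arctan (a 1) - seAngle μ k) = 2 * Real.arctan (a 1) := by
    field_simp; ring
  simp only [seSlab, seChartInv, mem_ofPred_eq, Matrix.cons_val]
  rw [h, abs_lt]
  constructor <;> linarith

theorem seChartFun_seChartInv {μ : ℝ} (hμ : 0 < μ) (hμ1 : μ ≠ 1) (k : ℤ) (a : Fin 3 → ℝ) :
    seChartFun μ k (seChartInv μ k a) = a := by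
  have hc := seConst_ne_zero hμ hμ1
  have h : μ * (seAngle μ k + 2 / μ * Real.arctan (a 1) - seAngle μ k) / 2 = Real.arctan (a 1) := by
    field_simp; ring
  have h1 : 1 + a 1 ^ 2 ≠ 0 := by positivity
  ext i
  fin_cases i <;>
    simp only [seChartFun, seChartInv, Matrix.cons_val, h, Real.tan_arctan, Fin.zero_eta,
      Fin.mk_one, Fin.reduceFinMk]
  · field_simp; ring
  · field_simp; ring

theorem seChartInv_seChartFun {μ : ℝ} (hμ : 0 < μ) (hμ1 : μ ≠ 1) (k : ℤ) {p : Fin 3 → ℝ}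
    (hp : p ∈ seSlab μ k) : seChartInv μ k (seChartFun μ k p) = p := by
  have hc := seConst_ne_zero hμ hμ1
  have h := abs_lt.1 (show |μ * (p 2 - seAngle μ k)| < Real.pi from hp)
  have ha : Real.arctan (Real.tan (μ * (p 2 - seAngle μ k) / 2)) = μ * (p 2 - seAngle μ k) / 2 :=
    Real.arctan_tan (by linarith [h.1]) (by linarith [h.2])
  have h1 : 1 + Real.tan (μ * (p 2 - seAngle μ k) / 2) ^ 2 ≠ 0 := by positivity
  ext i
  fin_cases i <;>
    simp only [seChartFun, seChartInv, Matrix.cons_val, ha, Fin.zero_eta,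
      Fin.mk_one, Fin.reduceFinMk]
  · field_simp; ring
  · field_simp; ring
  · field_simp; ring

theorem seChartInv_mem {μ : ℝ} (hμ : 0 < μ) (hμ1 : μ ≠ 1) (k : ℤ) {a : Fin 3 → ℝ}
    (ha : a ∈ DoubleCone 2) : seChartInv μ k a ∈ seSurface μ := by
  have hc := seConst_ne_zero hμ hμ1
  rw [mem_doubleCone_two] at ha
  have hcos := (cos_half_pos_of_mem_seSlab (seChartInv_mem_slab hμ k a)).ne'
  have h := sin_eq_tan_half hcos
  have h2 : μ * (seChartInv μ k a 2 - seAngle μ k) / 2 = Real.arctan (a 1) := by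
    simp only [seChartInv, Matrix.cons_val]
    field_simp; ring
  rw [h2, Real.tan_arctan] at h
  have h1 : 1 + a 1 ^ 2 ≠ 0 := by positivity
  rw [mem_seSurface, mul_pow, cos_sq_seAngle_add hμ k, eq_div_of_mul_eq h1 h]
  simp only [seChartInv, Matrix.cons_val]
  field_simp
  linear_combination -ha

/-! ### Analyticity of the charts, and the atlas. -/

theorem analyticOnNhd_pi_three {E : Type*} [NormedAddCommGroup E] [NormedSpace ℝ E]
    {f : E → Fin 3 → ℝ} {s : Set E} (h0 : AnalyticOnNhd ℝ (fun x => f x 0) s)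
    (h1 : AnalyticOnNhd ℝ (fun x => f x 1) s) (h2 : AnalyticOnNhd ℝ (fun x => f x 2) s) :
    AnalyticOnNhd ℝ f s := by
  refine AnalyticOnNhd.pi (f := fun i x => f x i) fun i => ?_
  fin_cases i
  exacts [h0, h1, h2]

theorem analyticOnNhd_eval {n : ℕ} (i : Fin n) (s : Set (Fin n → ℝ)) :
    AnalyticOnNhd ℝ (fun x : Fin n → ℝ => x i) s :=
  (ContinuousLinearMap.proj (R := ℝ) (φ := fun _ : Fin n => ℝ) i).analyticOnNhd s

theorem Real.analyticAt_arctan (x : ℝ) : AnalyticAt ℝ Real.arctan x :=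
  (Real.contDiff_arctan.contDiffAt).analyticAt

theorem Real.analyticAt_tan {x : ℝ} (h : Real.cos x ≠ 0) : AnalyticAt ℝ Real.tan x :=
  (Real.contDiffAt_tan.2 h).analyticAt

theorem analyticOnNhd_seChartFun (μ : ℝ) (k : ℤ) :
    AnalyticOnNhd ℝ (seChartFun μ k) (seSlab μ k) := by
  have ht : AnalyticOnNhd ℝ (fun p : Fin 3 → ℝ => Real.tan (μ * (p 2 - seAngle μ k) / 2))
      (seSlab μ k) := by
    intro p hp
    have h2 := analyticOnNhd_eval 2 (seSlab μ k) p hp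
    exact (Real.analyticAt_tan (cos_half_pos_of_mem_seSlab hp).ne').comp
      (f := fun p : Fin 3 → ℝ => μ * (p 2 - seAngle μ k) / 2)
      (((analyticAt_const.mul (h2.sub analyticAt_const))).div_const)
  have h0 := analyticOnNhd_eval 0 (seSlab μ k)
  have h1 := analyticOnNhd_eval 1 (seSlab μ k)
  have hw := (analyticOnNhd_const (v := (1 : ℝ))).add (ht.pow 2)
  refine analyticOnNhd_pi_three ?_ ht ?_
  · intro p hp
    exact ((hw p hp).div_const).mul (((h0 p hp).sub (h1 p hp)).div_const)
  · intro p hp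
    exact ((hw p hp).div_const).mul (((h0 p hp).add (h1 p hp)).div_const)

theorem analyticOnNhd_seChartInv (μ : ℝ) (k : ℤ) (s : Set (Fin 3 → ℝ)) :
    AnalyticOnNhd ℝ (seChartInv μ k) s := by
  have h0 := analyticOnNhd_eval 0 s
  have h1 := analyticOnNhd_eval 1 s
  have h2 := analyticOnNhd_eval 2 s
  have hw := (analyticOnNhd_const (v := (1 : ℝ)) (s := s)).add (h1.pow 2)
  refine analyticOnNhd_pi_three ?_ ?_ ?_
  · intro a ha
    exact (analyticAt_const.mul ((h2 a ha).add (h0 a ha))).div (hw a ha)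
      (by have : 0 < 1 + a 1 ^ 2 := by positivity
          exact this.ne')
  · intro a ha
    exact (analyticAt_const.mul ((h2 a ha).sub (h0 a ha))).div (hw a ha)
      (by have : 0 < 1 + a 1 ^ 2 := by positivity
          exact this.ne')
  · intro a ha
    exact analyticAt_const.add (analyticAt_const.mul
      ((Real.analyticAt_arctan _).comp (f := fun a : Fin 3 → ℝ => a 1) (h1 a ha)))

/-- The chart of the surface at the `k`-th DC-point, onto the whole cone. -/
noncomputable def seChart {μ : ℝ} (hμ : 0 < μ) (hμ1 : μ ≠ 1) (k : ℤ) :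
    OpenPartialHomeomorph (seSurface μ) (DoubleCone 2) where
  toFun p := ⟨seChartFun μ k p.1, seChartFun_mem hμ hμ1 k p.2⟩
  invFun a := ⟨seChartInv μ k a.1, seChartInv_mem hμ hμ1 k a.2⟩
  source := Subtype.val ⁻¹' seSlab μ k
  target := univ
  map_source' _ _ := mem_univ _
  map_target' a _ := seChartInv_mem_slab hμ k a.1
  left_inv' p hp := Subtype.ext (seChartInv_seChartFun hμ hμ1 k hp)
  right_inv' a _ := Subtype.ext (seChartFun_seChartInv hμ hμ1 k a.1)
  open_source := (isOpen_seSlab μ k).preimage continuous_subtype_val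
  open_target := isOpen_univ
  continuousOn_toFun := by
    refine Topology.IsInducing.subtypeVal.continuousOn_iff.2 ?_
    exact (analyticOnNhd_seChartFun μ k).continuousOn.comp continuous_subtype_val.continuousOn
      fun _ h => h
  continuousOn_invFun := by
    refine Topology.IsInducing.subtypeVal.continuousOn_iff.2 ?_
    exact (analyticOnNhd_seChartInv μ k univ).continuousOn.comp
      continuous_subtype_val.continuousOn fun _ _ => mem_univ _

/-- The cone is star-shaped about its vertex. -/
theorem isConnected_univ_doubleCone : IsConnected (univ : Set (DoubleCone 2)) := by
  have h0 : (0 : Fin 3 → ℝ) ∈ DoubleCone 2 := by simp [mem_doubleCone_two]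
  have hs : StarConvex ℝ 0 (DoubleCone 2) := by
    rw [starConvex_zero_iff]
    intro a ha t _ _
    rw [mem_doubleCone_two] at ha ⊢
    simp only [Pi.smul_apply, smul_eq_mul]
    linear_combination t ^ 2 * ha
  have := isConnected_iff_connectedSpace.1 (hs.isPathConnected h0).isConnected
  exact isConnected_univ

/-- The double-cone structure of the surface. -/
noncomputable def seDCStructure {μ : ℝ} (hμ : 0 < μ) (hμ1 : μ ≠ 1) :
    DCStructure 2 (seSurface μ) where
  locallyCompact := (isClosed_seSurface μ).isClosedEmbedding_subtypeVal.locallyCompactSpace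
  hausdorff := inferInstance
  secondCountable := inferInstance
  atlas := range (seChart hμ hμ1)
  cover p := by
    obtain ⟨k, hk⟩ := exists_abs_mul_sub_seAngle_lt hμ (p.1 2)
    exact ⟨_, mem_range_self k, hk⟩
  connected := by
    rintro _ ⟨k, rfl⟩
    exact isConnected_univ_doubleCone
  compatible := by
    rintro _ ⟨k, rfl⟩ _ ⟨j, rfl⟩
    refine ⟨seChartInv μ k ⁻¹' seSlab μ j, seChartFun μ j ∘ seChartInv μ k,
      (isOpen_seSlab μ j).preimage (continuousOn_univ.1
        (analyticOnNhd_seChartInv μ k univ).continuousOn), ?_, ?_, fun a _ => rfl⟩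
    · ext a
      simp [seChart]
    · exact (analyticOnNhd_seChartFun μ j).comp (analyticOnNhd_seChartInv μ k _) fun a ha => ha

/-! ### The vertex of the cone is an analytic invariant -/

/-- The cone contains a basis of ℝ³, so identities between linear maps need only be tested along its
generating lines. -/
theorem ContinuousLinearMap.eq_zero_of_doubleCone {F : Type*} [NormedAddCommGroup F]
    [NormedSpace ℝ F] (f : (Fin 3 → ℝ) →L[ℝ] F) (hf : ∀ v ∈ DoubleCone 2, f v = 0) : f = 0 := by
  have h1 := hf ![1, 0, 1] (by simp [mem_doubleCone_two])
  have h2 := hf ![1, 0, -1] (by simp [mem_doubleCone_two])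
  have h3 := hf ![0, 1, 1] (by simp [mem_doubleCone_two])
  ext v
  have hv : v = ((v 0 + v 2 - v 1) / 2) • ![1, 0, 1] + ((v 0 - v 2 + v 1) / 2) • ![1, 0, -1] +
      v 1 • ![0, 1, 1] := by
    ext i
    fin_cases i <;> simp <;> ring
  rw [hv, map_add, map_add, map_smul, map_smul, map_smul, h1, h2, h3]
  simp

theorem smul_mem_doubleCone {v : Fin 3 → ℝ} (hv : v ∈ DoubleCone 2) (t : ℝ) :
    t • v ∈ DoubleCone 2 := by
  rw [mem_doubleCone_two] at hv ⊢
  simp only [Pi.smul_apply, smul_eq_mul]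
  linear_combination t ^ 2 * hv

/-- An analytic local isomorphism of the double cone fixes the vertex. -/
theorem eq_zero_of_doubleCone_leftInverse {G H : (Fin 3 → ℝ) → Fin 3 → ℝ}
    (hG : AnalyticAt ℝ G 0) (hH : AnalyticAt ℝ H (G 0))
    (hGm : ∀ᶠ a in 𝓝 (0 : Fin 3 → ℝ), a ∈ DoubleCone 2 → G a ∈ DoubleCone 2 ∧ H (G a) = a) :
    G 0 = 0 := by
  have hline : ∀ v : Fin 3 → ℝ, HasDerivAt (fun t : ℝ => t • v) v 0 := fun v => by
    simpa using (hasDerivAt_id (0 : ℝ)).smul_const v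
  have hG' : ∀ v : Fin 3 → ℝ, HasDerivAt (fun t : ℝ => G (t • v)) (fderiv ℝ G 0 v) 0 := fun v =>
    HasFDerivAt.comp_hasDerivAt (x := (0 : ℝ)) (f := fun t : ℝ => t • v) (l := G)
      (by simpa using hG.differentiableAt.hasFDerivAt) (hline v)
  have hH' : ∀ v : Fin 3 → ℝ,
      HasDerivAt (fun t : ℝ => H (G (t • v))) (fderiv ℝ H (G 0) (fderiv ℝ G 0 v)) 0 := fun v =>
    HasFDerivAt.comp_hasDerivAt (x := (0 : ℝ)) (f := fun t : ℝ => G (t • v)) (l := H)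
      (by simpa using hH.differentiableAt.hasFDerivAt) (hG' v)
  have hev : ∀ v ∈ DoubleCone 2, ∀ᶠ t in 𝓝 (0 : ℝ),
      G (t • v) ∈ DoubleCone 2 ∧ H (G (t • v)) = t • v := by
    intro v hv
    have := (hline v).continuousAt.tendsto
    rw [zero_smul] at this
    filter_upwards [this.eventually hGm] with t ht using ht (smul_mem_doubleCone hv t)
  -- H ∘ G is the identity only on the cone, but differentiating along the lines tv in the cone
  -- fixes its derivative on a spanning set.
  have hid : fderiv ℝ H (G 0) ∘L fderiv ℝ G 0 - ContinuousLinearMap.id ℝ _ = 0 := by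
    refine ContinuousLinearMap.eq_zero_of_doubleCone _ fun v hv => ?_
    have h1 := (hH' v).congr_of_eventuallyEq
      (f₁ := fun t : ℝ => t • v) ((hev v hv).mono fun t ht => ht.2.symm)
    simpa [sub_eq_zero] using h1.unique (hline v)
  have hinj : Function.Injective (fderiv ℝ G 0) := by
    refine Function.LeftInverse.injective (g := fderiv ℝ H (G 0)) fun v => ?_
    have := congrArg (fun f => f v) hid
    simpa [sub_eq_zero] using this
  have hsurj : Function.Surjective (fderiv ℝ G 0) :=
    LinearMap.surjective_of_injective (f := (fderiv ℝ G 0).toLinearMap) hinj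
  let pr := fun i : Fin 3 => ContinuousLinearMap.proj (R := ℝ) (φ := fun _ : Fin 3 => ℝ) i
  -- The differential at G(0) of q = a₀² + a₁² - a₂². Since q(G(tv)) = 0 for v in the cone, ℓ kills
  -- the image of DG(0), which is everything; nondegeneracy of q then forces G(0) = 0.
  let ℓ : (Fin 3 → ℝ) →L[ℝ] ℝ := (2 * G 0 0) • pr 0 + (2 * G 0 1) • pr 1 - (2 * G 0 2) • pr 2
  have hℓ : ℓ ∘L fderiv ℝ G 0 = 0 := by
    refine ContinuousLinearMap.eq_zero_of_doubleCone _ fun v hv => ?_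
    have hd := fun i => hasDerivAt_pi.1 (hG' v) i
    have h1 := (((hd 0).pow 2).add ((hd 1).pow 2)).sub ((hd 2).pow 2)
    have h2 : HasDerivAt (fun _ : ℝ => (0 : ℝ)) 0 0 := hasDerivAt_const _ _
    have h3 := h1.congr_of_eventuallyEq (f₁ := fun _ : ℝ => (0 : ℝ)) ((hev v hv).mono fun t ht => by
      have := mem_doubleCone_two.1 ht.1
      simp only [Pi.sub_apply, Pi.add_apply, Pi.pow_apply]
      linarith)
    have h4 := h3.unique h2
    simp only [zero_smul, Nat.cast_ofNat, Nat.add_one_sub_one, pow_one] at h4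
    simp only [ContinuousLinearMap.comp_apply, ℓ, pr, sub_apply,
      add_apply, smul_apply,
      ContinuousLinearMap.proj_apply, smul_eq_mul]
    linarith
  have hz : ∀ w, ℓ w = 0 := fun w => by
    obtain ⟨v, rfl⟩ := hsurj w
    exact congrArg (fun f => f v) hℓ
  have e0 := hz ![1, 0, 0]
  have e1 := hz ![0, 1, 0]
  have e2 := hz ![0, 0, 1]
  simp [ℓ, pr] at e0 e1 e2
  ext i
  fin_cases i <;> simpa

namespace DCStructure

/-- A DC-point is defined through some compatible coordinate system; this lets any single atlas
chart decide the question. -/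
theorem dcPoints_eq_of_atlas {X : Type*} [TopologicalSpace X] (D : DCStructure 2 X)
    {e e' : OpenPartialHomeomorph X (DoubleCone 2)} (he : D.IsCoord e) (he' : e' ∈ D.atlas)
    {p : X} (hp : p ∈ e.source) (hp' : p ∈ e'.source) (h : (e p).1 = 0) : (e' p).1 = 0 := by
  obtain ⟨⟨Ω, G, hΩ, hΩs, hG, hGe⟩, Ω', H, hΩ', hΩs', hH, hHe⟩ := he e' he'
  have hmem : e p ∈ (e.symm.trans e').source := by
    simp [hp, hp']
  have h0 : (0 : Fin 3 → ℝ) ∈ Ω := by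
    rw [← h]
    exact hΩs.symm.subset hmem
  have hG0 : G 0 = (e' p).1 := by
    have := hGe _ hmem
    simp only [e.left_inv hp] at this
    rw [← h, this]
  have hH0 : G 0 ∈ Ω' := by
    rw [hG0]
    have : e' p ∈ (e'.symm.trans e).source := by simp [hp, hp']
    exact hΩs'.symm.subset this
  rw [← hG0]
  refine eq_zero_of_doubleCone_leftInverse (hG 0 h0) (hH _ hH0) ?_
  filter_upwards [hΩ.mem_nhds h0] with a ha hac
  have hms : (⟨a, hac⟩ : DoubleCone 2) ∈ (e.symm.trans e').source := hΩs ▸ ha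
  have hGa := hGe _ hms
  have hms2 : e.symm ⟨a, hac⟩ ∈ e.source ∧ e.symm ⟨a, hac⟩ ∈ e'.source := by
    rw [OpenPartialHomeomorph.trans_source] at hms
    exact ⟨e.map_target hms.1, hms.2⟩
  have hta : (⟨a, hac⟩ : DoubleCone 2) ∈ e.target := by
    rw [OpenPartialHomeomorph.trans_source] at hms
    exact hms.1
  have hms' : e' (e.symm ⟨a, hac⟩) ∈ (e'.symm.trans e).source := by
    simp [hms2.1, hms2.2]
  refine ⟨hGa ▸ (e' (e.symm ⟨a, hac⟩)).2, ?_⟩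
  simp only at hGa
  have hHa := hHe _ hms'
  simp only [e'.left_inv hms2.2, e.right_inv hta] at hHa
  rw [hGa, hHa]

end DCStructure

theorem ConeAnalyticOn.mono {m : ℕ} {F : Type*} [NormedAddCommGroup F] [NormedSpace ℝ F]
    {U V : Set (DoubleCone m)} {g : DoubleCone m → F} (h : ConeAnalyticOn U g) (hV : IsOpen V)
    (hVU : V ⊆ U) : ConeAnalyticOn V g := by
  obtain ⟨Ω, G, hΩ, hΩU, hG, hGg⟩ := h
  obtain ⟨Ω', hΩ', rfl⟩ := isOpen_induced_iff.1 hV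
  refine ⟨Ω ∩ Ω', G, hΩ.inter hΩ', ?_, hG.mono inter_subset_left, fun a ha => hGg a (hVU ha)⟩
  rw [preimage_inter, hΩU]
  exact inter_eq_right.2 hVU

namespace DCStructure

variable {m : ℕ} {X : Type*} [TopologicalSpace X] (D : DCStructure m X)

theorem isCoord_of_mem_atlas {e : OpenPartialHomeomorph X (DoubleCone m)} (he : e ∈ D.atlas) :
    D.IsCoord e := fun e' he' => ⟨D.compatible e he e' he', D.compatible e' he' e he⟩

theorem IsCoord.restr {e : OpenPartialHomeomorph X (DoubleCone m)} (he : D.IsCoord e) (s : Set X) :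
    D.IsCoord (e.restr s) := by
  refine fun e' he' => ⟨(he e' he').1.mono (OpenPartialHomeomorph.open_source _) ?_,
    (he e' he').2.mono (OpenPartialHomeomorph.open_source _) ?_⟩
  · intro a ha
    simp only [OpenPartialHomeomorph.trans_source, OpenPartialHomeomorph.symm_source,
      OpenPartialHomeomorph.restr_target, mem_inter_iff] at ha ⊢
    exact ⟨ha.1.1, ha.2⟩
  · intro a ha
    simp only [OpenPartialHomeomorph.trans_source, OpenPartialHomeomorph.restr_source,
      mem_inter_iff, preimage_inter] at ha ⊢
    exact ⟨ha.1, ha.2.1⟩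

end DCStructure

/-! ### First properties of the structure of the surface -/

section

variable {μ : ℝ} (hμ : 0 < μ) (hμ1 : μ ≠ 1)

theorem seChart_mem_atlas (k : ℤ) : seChart hμ hμ1 k ∈ (seDCStructure hμ hμ1).atlas :=
  mem_range_self k

theorem seChartFun_eq_zero_iff {μ : ℝ} (hμ : 0 < μ) (hμ1 : μ ≠ 1) {k : ℤ} {p : Fin 3 → ℝ}
    (hps : p ∈ seSurface μ) : seChartFun μ k p = 0 ↔ p 0 = 0 ∧ p 1 = 0 := by
  have hc := seConst_ne_zero hμ hμ1
  have hm := mem_doubleCone_two.1 (seChartFun_mem hμ hμ1 k hps)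
  have hw : (1 + Real.tan (μ * (p 2 - seAngle μ k) / 2) ^ 2) / (2 * seConst μ) ≠ 0 :=
    div_ne_zero (by positivity) (by simpa using hc)
  constructor
  · intro h
    have h0 : (1 + Real.tan (μ * (p 2 - seAngle μ k) / 2) ^ 2) / (2 * seConst μ) *
      ((p 0 - p 1) / 2) = 0 := congrFun h 0
    have h2 : (1 + Real.tan (μ * (p 2 - seAngle μ k) / 2) ^ 2) / (2 * seConst μ) *
      ((p 0 + p 1) / 2) = 0 := congrFun h 2
    have := (mul_eq_zero.1 h0).resolve_left hw
    have := (mul_eq_zero.1 h2).resolve_left hw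
    constructor <;> linarith
  · rintro ⟨h0, h1⟩
    have e0 : seChartFun μ k p 0 = 0 := by simp [seChartFun, h0, h1]
    have e2 : seChartFun μ k p 2 = 0 := by simp [seChartFun, h0, h1]
    rw [e0, e2] at hm
    have e1 : seChartFun μ k p 1 = 0 := by simpa using hm
    ext i
    fin_cases i
    exacts [e0, e1, e2]

theorem dcPoints_seDCStructure :
    (seDCStructure hμ hμ1).dcPoints = {p : seSurface μ | p.1 0 = 0 ∧ p.1 1 = 0} := by
  ext p
  obtain ⟨k, hk⟩ := exists_abs_mul_sub_seAngle_lt hμ (p.1 2)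
  have hiff := seChartFun_eq_zero_iff hμ hμ1 (k := k) p.2
  constructor
  · rintro ⟨e, he, hpe, h0⟩
    exact hiff.1 ((seDCStructure hμ hμ1).dcPoints_eq_of_atlas he (seChart_mem_atlas hμ hμ1 k)
      hpe hk h0)
  · intro h
    exact ⟨_, (seDCStructure hμ hμ1).isCoord_of_mem_atlas (seChart_mem_atlas hμ hμ1 k), hk,
      hiff.2 h⟩

/-- The restriction to the surface of an analytic map on `ℝ³` is DC-analytic. -/
theorem isDCAnalytic_of_analyticOnNhd {E : Type*} [NormedAddCommGroup E] [NormedSpace ℝ E]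
    {N : Set E} {f : seSurface μ → E} {F : (Fin 3 → ℝ) → E} (hF : AnalyticOnNhd ℝ F univ)
    (hfF : ∀ p, f p = F p.1) (hN : ∀ p, f p ∈ N) : (seDCStructure hμ hμ1).IsDCAnalytic N f := by
  refine ⟨hN, ?_⟩
  rintro _ ⟨k, rfl⟩
  exact ⟨univ, F ∘ seChartInv μ k, isOpen_univ, rfl,
    hF.comp (analyticOnNhd_seChartInv μ k univ) (mapsTo_univ _ _), fun a _ =>
      (hfF ((seChart hμ hμ1 k).symm a)).symm⟩

theorem continuous_seChartInv (k : ℤ) : Continuous (seChartInv μ k) :=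
  continuousOn_univ.1 (analyticOnNhd_seChartInv μ k univ).continuousOn

/-- A map on the surface is DC-regular if it is locally the restriction of an analytic
diffeomorphism from an open subset of `ℝ³`. -/
theorem isDCRegularAt_of_diffeo {E : Type*} [NormedAddCommGroup E] [NormedSpace ℝ E]
    {N W : Set E} {f : seSurface μ → E} {Ω : Set (Fin 3 → ℝ)} {Φ : E → Fin 3 → ℝ}
    {Ψ : (Fin 3 → ℝ) → E} {p : seSurface μ} {k : ℤ} (hd : IsAnalyticDiffeoOn N W Ω Φ Ψ)
    (hΦW : MapsTo Φ W (seSlab μ k)) (hΩ : Ω ⊆ seSlab μ k)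
    (hp : p.1 ∈ Ω) (hfW : ∀ q : seSurface μ, q.1 ∈ Ω → f q ∈ W ∧ Φ (f q) = q.1) :
    (seDCStructure hμ hμ1).IsDCRegularAt 0 N f p := by
  obtain ⟨hW, hΩo, hΦ, hΨ, hmΦ, hmΨ, hinv⟩ := hd
  have hs : IsOpen (Subtype.val ⁻¹' Ω : Set (seSurface μ)) := hΩo.preimage continuous_subtype_val
  refine ⟨(seChart hμ hμ1 k).restr (Subtype.val ⁻¹' Ω),
    ((seDCStructure hμ hμ1).isCoord_of_mem_atlas (seChart_mem_atlas hμ hμ1 k)).restr _ _, ?_,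
    -- The given diffeomorphism is followed by the chart's ambient extension. The second factor `Fin
    -- 0 → ℝ` is a point.
    W, (fun a => seChartInv μ k a.1) ⁻¹' Ω, fun x => (seChartFun μ k (Φ x), 0),
    fun a => Ψ (seChartInv μ k a.1), ⟨hW, ?_, ?_, ?_, ?_, ?_, ?_, ?_⟩, ?_⟩
  · rw [OpenPartialHomeomorph.restr_source, hs.interior_eq]
    exact ⟨hΩ hp, hp⟩
  · exact hΩo.preimage ((continuous_seChartInv k).comp continuous_fst)
  · exact ((analyticOnNhd_seChartFun μ k).comp hΦ hΦW).prod
      analyticOnNhd_const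
  · exact hΨ.comp ((analyticOnNhd_seChartInv μ k univ).comp
      (analyticOnNhd_fst) (mapsTo_univ _ _)) fun a ha => ha
  · intro x hx
    simpa only [mem_preimage, seChartInv_seChartFun hμ hμ1 k (hΩ (hmΦ hx))] using hmΦ hx
  · intro a ha
    exact hmΨ ha
  · intro x hx
    simp only [seChartInv_seChartFun hμ hμ1 k (hΩ (hmΦ hx))]
    exact hinv.1 hx
  · rintro ⟨a, b⟩ ha
    have : Φ (Ψ (seChartInv μ k a)) = seChartInv μ k a := hinv.2 ha
    simp only [this, seChartFun_seChartInv hμ hμ1]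
    exact Prod.ext rfl (Subsingleton.elim _ _)
  · intro q hq
    rw [OpenPartialHomeomorph.restr_source, hs.interior_eq] at hq
    refine ⟨(hfW q hq.2).1, ?_⟩
    simp only [(hfW q hq.2).2]
    rfl

theorem isDCImmersion_inclusion :
    (seDCStructure hμ hμ1).IsDCImmersion 0 univ (fun p : seSurface μ => (p : Fin 3 → ℝ)) := by
  refine ⟨isDCAnalytic_of_analyticOnNhd hμ hμ1 (F := id) analyticOnNhd_id (fun _ => rfl)
    fun _ => mem_univ _, fun p => ?_⟩
  obtain ⟨k, hk⟩ := exists_abs_mul_sub_seAngle_lt hμ (p.1 2)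
  exact isDCRegularAt_of_diffeo hμ hμ1 (W := seSlab μ k) (Ω := seSlab μ k) (Φ := id) (Ψ := id)
    ⟨isOpen_seSlab μ k, isOpen_seSlab μ k, analyticOnNhd_id, analyticOnNhd_id, fun x hx => hx.2,
      fun x hx => ⟨mem_univ _, hx⟩, fun _ _ => rfl, fun _ _ => rfl⟩ (fun x hx => hx) subset_rfl hk
      fun q hq => ⟨hq, rfl⟩

end

/-! ### The plane curve -/

theorem contDiff_seX1 (μ : ℝ) {n : WithTop ℕ∞} : ContDiff ℝ n (seX1 μ) := by
  unfold seX1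
  have := Real.contDiff_cos (n := n)
  have := Real.contDiff_sin (n := n)
  fun_prop

theorem contDiff_seX2 (μ : ℝ) {n : WithTop ℕ∞} : ContDiff ℝ n (seX2 μ) := by
  unfold seX2
  have := Real.contDiff_cos (n := n)
  have := Real.contDiff_sin (n := n)
  fun_prop

theorem ContDiff.analyticAt_of_omega {E F : Type*} [NormedAddCommGroup E] [NormedSpace ℝ E]
    [NormedAddCommGroup F] [NormedSpace ℝ F] {f : E → F} (h : ContDiff ℝ ⊤ f) (x : E) :
    AnalyticAt ℝ f x := h.contDiffAt.analyticAt

/-- After rotation by -θ the curve is (-(μ² + 1)/(2μ) cos(μθ), sin(μθ)), and ((μ² + 1)/(2μ))² = 1 +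
c². -/
theorem seX1_sq_add_seX2_sq {μ : ℝ} (hμ : 0 < μ) (θ : ℝ) :
    seX1 μ θ ^ 2 + seX2 μ θ ^ 2 = 1 + (seConst μ * Real.cos (μ * θ)) ^ 2 := by
  have h1 := Real.sin_sq_add_cos_sq θ
  have h2 := Real.sin_sq_add_cos_sq (μ * θ)
  unfold seX1 seX2 seConst
  set c := Real.cos θ
  set s := Real.sin θ
  set C := Real.cos (μ * θ)
  set S := Real.sin (μ * θ)
  field_simp
  linear_combination (4 * μ ^ 2 * S ^ 2 + (μ ^ 2 + 1) ^ 2 * C ^ 2) * h1 + 4 * μ ^ 2 * h2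

theorem hasDerivAt_seX1 {μ : ℝ} (hμ : 0 < μ) (θ : ℝ) :
    HasDerivAt (seX1 μ) (seConst μ * (μ * Real.sin (μ * θ) * Real.cos θ -
      Real.cos (μ * θ) * Real.sin θ)) θ := by
  have hm : HasDerivAt (fun θ : ℝ => μ * θ) μ θ := by simpa using (hasDerivAt_id θ).const_mul μ
  have h1 := (((Real.hasDerivAt_cos θ).const_mul (μ ^ 2 + 1)).mul hm.cos).neg.div_const (2 * μ)
  have h2 := (Real.hasDerivAt_sin θ).mul hm.sin
  refine (h1.sub h2).congr_deriv ?_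
  unfold seConst
  field_simp
  ring

theorem hasDerivAt_seX2 {μ : ℝ} (hμ : 0 < μ) (θ : ℝ) :
    HasDerivAt (seX2 μ) (seConst μ * (μ * Real.sin (μ * θ) * Real.sin θ +
      Real.cos (μ * θ) * Real.cos θ)) θ := by
  have hm : HasDerivAt (fun θ : ℝ => μ * θ) μ θ := by simpa using (hasDerivAt_id θ).const_mul μ
  have h1 := (((Real.hasDerivAt_sin θ).const_mul (μ ^ 2 + 1)).mul hm.cos).neg.div_const (2 * μ)
  have h2 := (Real.hasDerivAt_cos θ).mul hm.sin
  refine (h1.add h2).congr_deriv ?_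
  unfold seConst
  field_simp
  ring

/-- The curve is transversal to the radial direction. -/
theorem seX_wedge_ne_zero {μ : ℝ} (hμ : 0 < μ) (hμ1 : μ ≠ 1) (θ : ℝ) :
    seX1 μ θ * (seConst μ * (μ * Real.sin (μ * θ) * Real.sin θ +
      Real.cos (μ * θ) * Real.cos θ)) - seX2 μ θ * (seConst μ * (μ * Real.sin (μ * θ) * Real.cos θ -
      Real.cos (μ * θ) * Real.sin θ)) ≠ 0 := by
  have hc := seConst_ne_zero hμ hμ1
  have h1 := Real.sin_sq_add_cos_sq θ
  have h2 := Real.sin_sq_add_cos_sq (μ * θ)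
  -- The determinant is -c times a positive definite form in (cos(μθ), sin(μθ)).
  have h : seX1 μ θ * (seConst μ * (μ * Real.sin (μ * θ) * Real.sin θ +
      Real.cos (μ * θ) * Real.cos θ)) - seX2 μ θ * (seConst μ * (μ * Real.sin (μ * θ) * Real.cos θ -
      Real.cos (μ * θ) * Real.sin θ)) =
      -seConst μ * ((μ ^ 2 + 1) / (2 * μ) * Real.cos (μ * θ) ^ 2 + μ * Real.sin (μ * θ) ^ 2) := by
    unfold seX1 seX2
    set c := Real.cos θ
    set s := Real.sin θ
    set C := Real.cos (μ * θ)
    set S := Real.sin (μ * θ)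
    field_simp
    linear_combination (-((μ ^ 2 + 1) * C ^ 2 + 2 * μ ^ 2 * S ^ 2)) * h1
  rw [h]
  refine mul_ne_zero (neg_ne_zero.2 hc) (ne_of_gt ?_)
  by_cases hC : Real.cos (μ * θ) = 0
  · rw [hC] at h2 ⊢
    have : Real.sin (μ * θ) ^ 2 = 1 := by linarith
    rw [this]
    simpa
  · positivity

/-! ### The extension as a DC-immersion -/

theorem mem_deSitter {x : Fin 4 → ℝ} :
    x ∈ deSitter ↔ x 1 ^ 2 + x 2 ^ 2 = 1 + (x 0 + x 3) * (x 0 - x 3) := by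
  simp only [deSitter, minkowski, mem_ofPred_eq]
  constructor <;> intro h <;> linarith

theorem seExtension_mem {μ : ℝ} (hμ : 0 < μ) (p : seSurface μ) : seExtension μ p ∈ deSitter := by
  have h := mem_seSurface.1 p.2
  have h1 := seX1_sq_add_seX2_sq hμ (p.1 2)
  simp only [mem_deSitter, seExtension, Matrix.cons_val]
  linarith

theorem analyticOnNhd_pi_four {E : Type*} [NormedAddCommGroup E] [NormedSpace ℝ E]
    {f : E → Fin 4 → ℝ} {s : Set E} (h0 : AnalyticOnNhd ℝ (fun x => f x 0) s)
    (h1 : AnalyticOnNhd ℝ (fun x => f x 1) s) (h2 : AnalyticOnNhd ℝ (fun x => f x 2) s)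
    (h3 : AnalyticOnNhd ℝ (fun x => f x 3) s) :
    AnalyticOnNhd ℝ f s := by
  refine AnalyticOnNhd.pi (f := fun i x => f x i) fun i => ?_
  fin_cases i
  exacts [h0, h1, h2, h3]

/-- The map `(ξ, η, θ) ↦ ((ξ + η)/2, x₁(θ), x₂(θ), (ξ - η)/2)` on the whole of `ℝ³`. -/
noncomputable def seAmbient (μ : ℝ) (p : Fin 3 → ℝ) : Fin 4 → ℝ :=
  ![(p 0 + p 1) / 2, seX1 μ (p 2), seX2 μ (p 2), (p 0 - p 1) / 2]

theorem analyticOnNhd_seAmbient (μ : ℝ) : AnalyticOnNhd ℝ (seAmbient μ) univ := by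
  have h0 := analyticOnNhd_eval (n := 3) 0 univ
  have h1 := analyticOnNhd_eval (n := 3) 1 univ
  have h2 := analyticOnNhd_eval (n := 3) 2 univ
  refine analyticOnNhd_pi_four ?_ ?_ ?_ ?_ <;> intro p hp
  · exact ((h0 p hp).add (h1 p hp)).div_const
  · exact ((contDiff_seX1 μ).analyticAt_of_omega _).comp (f := fun p : Fin 3 → ℝ => p 2) (h2 p hp)
  · exact ((contDiff_seX2 μ).analyticAt_of_omega _).comp (f := fun p : Fin 3 → ℝ => p 2) (h2 p hp)
  · exact ((h0 p hp).sub (h1 p hp)).div_const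

theorem isDCAnalytic_seExtension {μ : ℝ} (hμ : 0 < μ) (hμ1 : μ ≠ 1) :
    (seDCStructure hμ hμ1).IsDCAnalytic deSitter (seExtension μ) :=
  isDCAnalytic_of_analyticOnNhd hμ hμ1 (analyticOnNhd_seAmbient μ) (fun _ => rfl)
    (seExtension_mem hμ)

/-- The analytic inverse function theorem, between prescribed open sets. -/
theorem exists_analytic_local_inverse {E : Type*} [NormedAddCommGroup E] [NormedSpace ℝ E]
    [FiniteDimensional ℝ E] {f : E → E} (hf : AnalyticOnNhd ℝ f univ) {a : E}
    (ha : Function.Injective (fderiv ℝ f a)) {V : Set E} (hV : IsOpen V) (haV : a ∈ V) :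
    ∃ (S T : Set E) (g : E → E), IsOpen S ∧ IsOpen T ∧ a ∈ S ∧ S ⊆ V ∧ MapsTo f S T ∧
      MapsTo g T S ∧ InvOn g f S T ∧ AnalyticOnNhd ℝ g T := by
  have : CompleteSpace E := FiniteDimensional.complete ℝ E
  let i : E ≃L[ℝ] E := (LinearEquiv.ofInjectiveEndo (fderiv ℝ f a).toLinearMap ha).toContinuousLinearEquiv
  have hi : fderiv ℝ f a = (i : E →L[ℝ] E) := by
    ext v
    rfl
  have hs : HasStrictFDerivAt f (i : E →L[ℝ] E) a := hi ▸ (hf a (mem_univ _)).hasStrictFDerivAt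
  let e := hs.toOpenPartialHomeomorph f
  have hae : a ∈ e.source := hs.mem_toOpenPartialHomeomorph_source
  have hfe : ∀ x, e x = f x := fun _ => rfl
  have hana : AnalyticAt ℝ e.symm (f a) := e.analyticAt_symm' hae (hf a (mem_univ _)) hi
  -- The inverse is analytic on an open set containing f(a); source and target are both cut down by
  -- that condition and by V so that they still correspond.
  have hfc : Continuous f := continuousOn_univ.1 hf.continuousOn
  have hTo : IsOpen {y | AnalyticAt ℝ e.symm y} := isOpen_analyticAt ℝ e.symm
  refine ⟨e.source ∩ (V ∩ f ⁻¹' {y | AnalyticAt ℝ e.symm y}),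
    e.target ∩ e.symm ⁻¹' V ∩ {y | AnalyticAt ℝ e.symm y}, e.symm,
    e.open_source.inter (hV.inter (hTo.preimage hfc)),
    (e.symm.isOpen_inter_preimage hV).inter hTo, ⟨hae, haV, hana⟩, fun x hx => hx.2.1,
    ?_, ?_, ⟨?_, ?_⟩, fun y hy => hy.2⟩
  · rintro x ⟨hx, hxV, hxa⟩
    refine ⟨⟨e.map_source hx, ?_⟩, hxa⟩
    rw [← hfe, mem_preimage, e.left_inv hx]
    exact hxV
  · rintro y ⟨⟨hy, hyV⟩, hya⟩
    refine ⟨e.map_target hy, hyV, ?_⟩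
    rw [mem_preimage, ← hfe, e.right_inv hy]
    exact hya
  · rintro x ⟨hx, -⟩
    exact e.left_inv hx
  · rintro y ⟨⟨hy, -⟩, -⟩
    exact e.right_inv hy

/-- The homothety of the plane curve. -/
noncomputable def sePolar (μ : ℝ) (v : ℝ × ℝ) : ℝ × ℝ := (v.2 * seX1 μ v.1, v.2 * seX2 μ v.1)

theorem contDiff_sePolar (μ : ℝ) {n : WithTop ℕ∞} : ContDiff ℝ n (sePolar μ) := by
  unfold sePolar
  have := contDiff_seX1 μ (n := n)
  have := contDiff_seX2 μ (n := n)
  fun_prop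

theorem injective_fderiv_sePolar {μ : ℝ} (hμ : 0 < μ) (hμ1 : μ ≠ 1) (θ : ℝ) :
    Function.Injective (fderiv ℝ (sePolar μ) (θ, 1)) := by
  have hf : HasFDerivAt (fun v : ℝ × ℝ => v.1) (ContinuousLinearMap.fst ℝ ℝ ℝ) (θ, 1) :=
    hasFDerivAt_fst
  have h1 : HasFDerivAt (fun v : ℝ × ℝ => seX1 μ v.1) _ (θ, 1) :=
    HasDerivAt.comp_hasFDerivAt (θ, (1 : ℝ)) (h₂ := seX1 μ) (hasDerivAt_seX1 hμ θ) hf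
  have h2 : HasFDerivAt (fun v : ℝ × ℝ => seX2 μ v.1) _ (θ, 1) :=
    HasDerivAt.comp_hasFDerivAt (θ, (1 : ℝ)) (h₂ := seX2 μ) (hasDerivAt_seX2 hμ θ) hf
  have hs : HasFDerivAt (fun v : ℝ × ℝ => v.2) (ContinuousLinearMap.snd ℝ ℝ ℝ) (θ, 1) :=
    hasFDerivAt_snd
  have hd := ((hs.mul h1).prodMk (hs.mul h2)).fderiv
  rw [show fderiv ℝ (sePolar μ) (θ, 1) = _ from hd, injective_iff_map_eq_zero]
  rintro ⟨a, b⟩ hab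
  have hw := seX_wedge_ne_zero hμ hμ1 θ
  simp at hab
  obtain ⟨e1, e2⟩ := hab
  set y1 := seConst μ * (μ * Real.sin (μ * θ) * Real.cos θ - Real.cos (μ * θ) * Real.sin θ)
  set y2 := seConst μ * (μ * Real.sin (μ * θ) * Real.sin θ + Real.cos (μ * θ) * Real.cos θ)
  have ha : (seX1 μ θ * y2 - seX2 μ θ * y1) * a = 0 := by
    linear_combination seX1 μ θ * e2 - seX2 μ θ * e1
  have hb : (seX1 μ θ * y2 - seX2 μ θ * y1) * b = 0 := by
    linear_combination y2 * e1 - y1 * e2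
  rw [(mul_eq_zero.1 ha).resolve_left hw, (mul_eq_zero.1 hb).resolve_left hw]
  rfl

theorem isDCImmersion_seExtension {μ : ℝ} (hμ : 0 < μ) (hμ1 : μ ≠ 1) :
    (seDCStructure hμ hμ1).IsDCImmersion 0 deSitter (seExtension μ) := by
  refine ⟨isDCAnalytic_seExtension hμ hμ1, fun p => ?_⟩
  obtain ⟨k, hk⟩ := exists_abs_mul_sub_seAngle_lt hμ (p.1 2)
  have hV : IsOpen {v : ℝ × ℝ | |μ * (v.1 - seAngle μ k)| < Real.pi ∧ 0 < v.2} :=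
    IsOpen.and (isOpen_lt (by fun_prop) (by fun_prop)) (isOpen_lt (by fun_prop) (by fun_prop))
  obtain ⟨S, T, g, hS, hT, hpS, hSV, hmST, hmTS, hinv, hg⟩ := exists_analytic_local_inverse
    (f := sePolar μ) (fun v _ => (contDiff_sePolar μ).analyticAt_of_omega v)
    (injective_fderiv_sePolar hμ hμ1 (p.1 2)) hV ⟨hk, one_pos⟩
  -- For given ξ, η, θ with 1 + ξη > 0, this is the factor for which ργ(θ) satisfies the de Sitter
  -- equation. It equals 1 exactly where the surface equation holds.
  let ρ : (Fin 3 → ℝ) → ℝ := fun q =>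
    Real.sqrt ((1 + q 0 * q 1) / (1 + (seConst μ * Real.cos (μ * q 2)) ^ 2))
  have hden : ∀ t, 0 < 1 + (seConst μ * Real.cos (μ * t)) ^ 2 := fun t => by positivity
  have hρc : Continuous ρ := by
    refine Real.continuous_sqrt.comp (Continuous.div (by fun_prop) (by fun_prop) fun q => ?_)
    exact (hden _).ne'
  have hρ1 : ∀ q ∈ seSurface μ, ρ q = 1 := by
    intro q hq
    simp only [ρ]
    rw [mem_seSurface.1 hq, div_self (hden _).ne', Real.sqrt_one]
  let W : Set (Fin 4 → ℝ) := {x | (x 1, x 2) ∈ T}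
  let Ω : Set (Fin 3 → ℝ) := {q | 0 < 1 + q 0 * q 1 ∧ (q 2, ρ q) ∈ S}
  have hx12 : AnalyticOnNhd ℝ (fun x : Fin 4 → ℝ => (x 1, x 2)) W :=
    (analyticOnNhd_eval 1 W).prod (analyticOnNhd_eval 2 W)
  have hgx : AnalyticOnNhd ℝ (fun x : Fin 4 → ℝ => (g (x 1, x 2)).1) W := fun x hx =>
    (analyticAt_fst (p := g (x 1, x 2))).comp (f := fun x : Fin 4 → ℝ => g (x 1, x 2))
      ((hg _ hx).comp (f := fun x : Fin 4 → ℝ => (x 1, x 2)) (hx12 x hx))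
  have hρa : AnalyticOnNhd ℝ ρ Ω := by
    intro q hq
    have hd : ContDiff ℝ ⊤ (fun q : Fin 3 → ℝ =>
        (1 + q 0 * q 1) / (1 + (seConst μ * Real.cos (μ * q 2)) ^ 2)) := by
      have := Real.contDiff_cos (n := ⊤)
      exact ContDiff.div (by fun_prop) (by fun_prop) fun q => (hden _).ne'
    exact (hd.contDiffAt.sqrt (div_pos hq.1 (hden _)).ne').analyticAt
  have hsq : ∀ q ∈ Ω, ρ q ^ 2 * (1 + (seConst μ * Real.cos (μ * q 2)) ^ 2) = 1 + q 0 * q 1 := by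
    intro q hq
    simp only [ρ]
    rw [Real.sq_sqrt (div_pos hq.1 (hden _)).le, div_mul_cancel₀ _ (hden _).ne']
  have hρg : ∀ x ∈ deSitter ∩ W,
      ρ ![x 0 + x 3, x 0 - x 3, (g (x 1, x 2)).1] = (g (x 1, x 2)).2 ∧
        0 < 1 + (x 0 + x 3) * (x 0 - x 3) := by
    rintro x ⟨hx, hxW⟩
    have hpos := (hSV (hmTS hxW)).2
    have hP := hinv.2 hxW
    have h1 : (g (x 1, x 2)).2 * seX1 μ (g (x 1, x 2)).1 = x 1 := congrArg Prod.fst hP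
    have h2 : (g (x 1, x 2)).2 * seX2 μ (g (x 1, x 2)).1 = x 2 := congrArg Prod.snd hP
    have h3 := seX1_sq_add_seX2_sq hμ (g (x 1, x 2)).1
    have h4 := mem_deSitter.1 hx
    have h5 : 1 + (x 0 + x 3) * (x 0 - x 3) =
        (g (x 1, x 2)).2 ^ 2 * (1 + (seConst μ * Real.cos (μ * (g (x 1, x 2)).1)) ^ 2) := by
      rw [← h4, ← h3]
      linear_combination -(x 1 + (g (x 1, x 2)).2 * seX1 μ (g (x 1, x 2)).1) * h1 -
        (x 2 + (g (x 1, x 2)).2 * seX2 μ (g (x 1, x 2)).1) * h2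
    constructor
    · simp only [ρ, Matrix.cons_val]
      rw [h5, mul_div_cancel_right₀ _ (hden _).ne', Real.sqrt_sq hpos.le]
    · rw [h5]
      exact mul_pos (pow_pos hpos 2) (hden _)
  -- The coordinates of de Sitter space are ξ, η and the angle θ solving (x₁, x₂) = ργ(θ); the
  -- radial factor is redundant there and is recovered as ρ.
  refine isDCRegularAt_of_diffeo hμ hμ1 (W := W) (Ω := Ω) (k := k)
    (Φ := fun x => ![x 0 + x 3, x 0 - x 3, (g (x 1, x 2)).1])
    (Ψ := fun q => ![(q 0 + q 1) / 2, ρ q * seX1 μ (q 2), ρ q * seX2 μ (q 2), (q 0 - q 1) / 2])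
    ⟨?_, ?_, ?_, ?_, ?_, ?_, ?_, ?_⟩ ?_ ?_ ?_ ?_
  · exact hT.preimage (f := fun x : Fin 4 → ℝ => (x 1, x 2)) (by fun_prop)
  · exact IsOpen.and (isOpen_lt (by fun_prop) (by fun_prop))
      (hS.preimage (f := fun q : Fin 3 → ℝ => (q 2, ρ q)) (by fun_prop))
  · exact analyticOnNhd_pi_three ((analyticOnNhd_eval 0 W).add (analyticOnNhd_eval 3 W))
      ((analyticOnNhd_eval 0 W).sub (analyticOnNhd_eval 3 W)) hgx
  · have ha := (analyticOnNhd_seAmbient μ).mono (subset_univ Ω)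
    have ha1 : AnalyticOnNhd ℝ (fun q : Fin 3 → ℝ => seX1 μ (q 2)) Ω :=
      (analyticOnNhd_eval 1 univ).comp ha (mapsTo_univ _ _)
    have ha2 : AnalyticOnNhd ℝ (fun q : Fin 3 → ℝ => seX2 μ (q 2)) Ω :=
      (analyticOnNhd_eval 2 univ).comp ha (mapsTo_univ _ _)
    have ha0 : AnalyticOnNhd ℝ (fun q : Fin 3 → ℝ => (q 0 + q 1) / 2) Ω :=
      (analyticOnNhd_eval 0 univ).comp ha (mapsTo_univ _ _)
    have ha3 : AnalyticOnNhd ℝ (fun q : Fin 3 → ℝ => (q 0 - q 1) / 2) Ω :=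
      (analyticOnNhd_eval 3 univ).comp ha (mapsTo_univ _ _)
    exact analyticOnNhd_pi_four ha0 (hρa.mul ha1) (hρa.mul ha2) ha3
  · rintro x hx
    refine ⟨by simpa using (hρg x hx).2, ?_⟩
    rw [(hρg x hx).1]
    exact hmTS hx.2
  · rintro q hq
    refine ⟨mem_deSitter.2 ?_, hmST hq.2⟩
    have h3 := seX1_sq_add_seX2_sq hμ (q 2)
    have h4 := hsq q hq
    simp only [Matrix.cons_val]
    linear_combination ρ q ^ 2 * h3 + h4
  · intro x hx
    have hP := hinv.2 hx.2
    have h1 : (g (x 1, x 2)).2 * seX1 μ (g (x 1, x 2)).1 = x 1 := congrArg Prod.fst hP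
    have h2 : (g (x 1, x 2)).2 * seX2 μ (g (x 1, x 2)).1 = x 2 := congrArg Prod.snd hP
    simp only [(hρg x hx).1]
    ext i
    fin_cases i <;> simp [h1, h2]
  · intro q hq
    have hP : g (ρ q * seX1 μ (q 2), ρ q * seX2 μ (q 2)) = (q 2, ρ q) := hinv.1 hq.2
    ext i
    fin_cases i <;> simp [hP] <;> ring
  · intro x hx
    exact (hSV (hmTS hx)).1
  · intro q hq
    exact (hSV hq.2).1
  · refine ⟨?_, ?_⟩
    · rw [mem_seSurface.1 p.2]
      exact hden _
    · rw [hρ1 _ p.2]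
      exact hpS
  · intro q hq
    have hq1 : sePolar μ (q.1 2, 1) = (seX1 μ (q.1 2), seX2 μ (q.1 2)) := by
      simp [sePolar]
    have hqS : (q.1 2, (1 : ℝ)) ∈ S := by
      have := hq.2
      rwa [hρ1 _ q.2] at this
    have hT1 : (seX1 μ (q.1 2), seX2 μ (q.1 2)) ∈ T := hq1 ▸ hmST hqS
    have hP : g (seX1 μ (q.1 2), seX2 μ (q.1 2)) = (q.1 2, 1) := by
      rw [← hq1]
      exact hinv.1 hqS
    refine ⟨hT1, ?_⟩
    ext i
    fin_cases i <;> simp [seExtension, hP] <;> ring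

/-! ### Local parametrizations and the mean curvature -/

/-- The linear form with coefficients `a`, `b` on the plane. -/
noncomputable def planeForm (a b : ℝ) : ℝ × ℝ →L[ℝ] ℝ :=
  a • ContinuousLinearMap.fst ℝ ℝ ℝ + b • ContinuousLinearMap.snd ℝ ℝ ℝ

theorem planeForm_apply (a b : ℝ) (v : ℝ × ℝ) : planeForm a b v = a * v.1 + b * v.2 := by
  simp [planeForm]

theorem HasDerivAt.hasFDerivAt_mul_planeForm {f g : ℝ → ℝ} {f' g' : ℝ} {v : ℝ × ℝ}
    (hf : HasDerivAt f f' v.1) (hg : HasDerivAt g g' v.2) :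
    HasFDerivAt (fun w : ℝ × ℝ => f w.1 * g w.2) (planeForm (f' * g v.2) (f v.1 * g')) v := by
  have h1 : HasFDerivAt (fun w : ℝ × ℝ => w.1) (ContinuousLinearMap.fst ℝ ℝ ℝ) v := hasFDerivAt_fst
  have h2 : HasFDerivAt (fun w : ℝ × ℝ => w.2) (ContinuousLinearMap.snd ℝ ℝ ℝ) v := hasFDerivAt_snd
  refine ((hf.comp_hasFDerivAt v h1).mul (hg.comp_hasFDerivAt v h2)).congr_fderiv ?_
  ext <;> simp [planeForm, mul_comm]

theorem hasFDerivAt_const_planeForm (a : ℝ) (v : ℝ × ℝ) :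
    HasFDerivAt (fun _ : ℝ × ℝ => a) (planeForm 0 0) v := by
  simpa [planeForm] using hasFDerivAt_const a v

theorem HasDerivAt.hasFDerivAt_snd_planeForm {g : ℝ → ℝ} {g' : ℝ} {v : ℝ × ℝ}
    (hg : HasDerivAt g g' v.2) :
    HasFDerivAt (fun w : ℝ × ℝ => g w.2) (planeForm 0 g') v := by
  simpa using (hasDerivAt_const v.1 (1 : ℝ)).hasFDerivAt_mul_planeForm hg

theorem HasFDerivAt.add_planeForm {f g : ℝ × ℝ → ℝ} {a b c d : ℝ} {v : ℝ × ℝ}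
    (hf : HasFDerivAt f (planeForm a b) v) (hg : HasFDerivAt g (planeForm c d) v) :
    HasFDerivAt (fun w => f w + g w) (planeForm (a + c) (b + d)) v := by
  refine (hf.add hg).congr_fderiv ?_
  ext <;> simp [planeForm]

theorem HasFDerivAt.const_mul_planeForm {f : ℝ × ℝ → ℝ} {a b : ℝ} {v : ℝ × ℝ}
    (hf : HasFDerivAt f (planeForm a b) v) (c : ℝ) :
    HasFDerivAt (fun w => f w * c) (planeForm (a * c) (b * c)) v := by
  refine (hf.mul_const c).congr_fderiv ?_
  ext <;> simp [planeForm, mul_comm]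

/-- The vector with null coordinates `v`, `w` in the `(x₀, x₃)`-plane. -/
noncomputable def nullVec (ε v w x y : ℝ) : Fin 4 → ℝ := ![(v + w) / 2, x, y, ε * (v - w) / 2]

theorem minkowski_nullVec {ε : ℝ} (hε : ε ^ 2 = 1) (v w x y v' w' x' y' : ℝ) :
    minkowski (nullVec ε v w x y) (nullVec ε v' w' x' y') =
      -(v * w' + w * v') / 2 + x * x' + y * y' := by
  simp only [minkowski, nullVec, Matrix.cons_val]
  linear_combination (v - w) * (v' - w') / 4 * hε

theorem fderiv_nullVec {ε : ℝ} {v w x y : ℝ × ℝ → ℝ} {a0 b0 a1 b1 a2 b2 a3 b3 : ℝ} {z : ℝ × ℝ}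
    (hv : HasFDerivAt v (planeForm a0 b0) z) (hw : HasFDerivAt w (planeForm a1 b1) z)
    (hx : HasFDerivAt x (planeForm a2 b2) z) (hy : HasFDerivAt y (planeForm a3 b3) z)
    (a : ℝ × ℝ) :
    fderiv ℝ (fun z => nullVec ε (v z) (w z) (x z) (y z)) z a =
      nullVec ε (a0 * a.1 + b0 * a.2) (a1 * a.1 + b1 * a.2) (a2 * a.1 + b2 * a.2)
        (a3 * a.1 + b3 * a.2) := by
  have h0 := (hv.add hw).mul_const (2⁻¹ : ℝ)
  have h3 := (hv.sub hw).mul_const (ε * 2⁻¹)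
  have h : HasFDerivAt (fun z => nullVec ε (v z) (w z) (x z) (y z))
      (ContinuousLinearMap.pi ![(2⁻¹ : ℝ) • (planeForm a0 b0 + planeForm a1 b1), planeForm a2 b2,
        planeForm a3 b3, (ε * 2⁻¹) • (planeForm a0 b0 - planeForm a1 b1)]) z := by
    rw [hasFDerivAt_pi']
    intro i
    fin_cases i
    · exact h0
    · exact hx
    · exact hy
    · refine h3.congr_of_eventuallyEq (Eventually.of_forall fun z => ?_)
      simp [nullVec]
      ring
  rw [h.fderiv]
  ext i
  fin_cases i <;> simp [nullVec, planeForm_apply] <;> ring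

/-- The square `((μ² - 1) cos (μθ)/(2μ))²`. -/
noncomputable def seProd (μ θ : ℝ) : ℝ := (seConst μ * Real.cos (μ * θ)) ^ 2

theorem hasDerivAt_mul_left_id (μ θ : ℝ) : HasDerivAt (fun θ : ℝ => μ * θ) μ θ := by
  simpa using (hasDerivAt_id θ).const_mul μ

theorem hasDerivAt_seProd (μ θ : ℝ) : HasDerivAt (seProd μ)
    (-2 * seConst μ ^ 2 * μ * (Real.cos (μ * θ) * Real.sin (μ * θ))) θ := by
  refine (((hasDerivAt_mul_left_id μ θ).cos.const_mul (seConst μ)).pow 2).congr_deriv ?_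
  simp
  ring

theorem hasDerivAt_deriv_seProd (μ θ : ℝ) :
    HasDerivAt (fun θ => -2 * seConst μ ^ 2 * μ * (Real.cos (μ * θ) * Real.sin (μ * θ)))
      (-2 * seConst μ ^ 2 * μ ^ 2 * (Real.cos (μ * θ) ^ 2 - Real.sin (μ * θ) ^ 2)) θ := by
  have hm := hasDerivAt_mul_left_id μ θ
  refine ((hm.cos.mul hm.sin).const_mul (-2 * seConst μ ^ 2 * μ)).congr_deriv ?_
  ring

theorem hasDerivAt_deriv_seX1 (μ θ : ℝ) :
    HasDerivAt (fun θ => seConst μ * (μ * Real.sin (μ * θ) * Real.cos θ -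
      Real.cos (μ * θ) * Real.sin θ))
      ((μ ^ 2 - 1) * seConst μ * Real.cos (μ * θ) * Real.cos θ) θ := by
  have hm := hasDerivAt_mul_left_id μ θ
  refine ((((hm.sin.const_mul μ).mul (Real.hasDerivAt_cos θ)).sub
    (hm.cos.mul (Real.hasDerivAt_sin θ))).const_mul (seConst μ)).congr_deriv ?_
  ring

theorem hasDerivAt_deriv_seX2 (μ θ : ℝ) :
    HasDerivAt (fun θ => seConst μ * (μ * Real.sin (μ * θ) * Real.sin θ +
      Real.cos (μ * θ) * Real.cos θ))
      ((μ ^ 2 - 1) * seConst μ * Real.cos (μ * θ) * Real.sin θ) θ := by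
  have hm := hasDerivAt_mul_left_id μ θ
  refine ((((hm.sin.const_mul μ).mul (Real.hasDerivAt_sin θ)).add
    (hm.cos.mul (Real.hasDerivAt_cos θ))).const_mul (seConst μ)).congr_deriv ?_
  ring

/-- The extension in the coordinates `(ξ, θ)` (for `ε = 1`) or `(η, θ)` (for `ε = -1`). -/
noncomputable def seNull (μ ε : ℝ) (v : ℝ × ℝ) : Fin 4 → ℝ :=
  nullVec ε v.1 (v.1⁻¹ * seProd μ v.2) (seX1 μ v.2) (seX2 μ v.2)

theorem fderiv_seNull {μ : ℝ} (hμ : 0 < μ) (ε : ℝ) {v : ℝ × ℝ} (hv : v.1 ≠ 0) (a : ℝ × ℝ) :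
    fderiv ℝ (seNull μ ε) v a = nullVec ε a.1
      (-(v.1 ^ 2)⁻¹ * seProd μ v.2 * a.1 +
        v.1⁻¹ * (-2 * seConst μ ^ 2 * μ * (Real.cos (μ * v.2) * Real.sin (μ * v.2))) * a.2)
      (seConst μ * (μ * Real.sin (μ * v.2) * Real.cos v.2 -
        Real.cos (μ * v.2) * Real.sin v.2) * a.2)
      (seConst μ * (μ * Real.sin (μ * v.2) * Real.sin v.2 +
        Real.cos (μ * v.2) * Real.cos v.2) * a.2) := by
  have h0 : HasFDerivAt (fun w : ℝ × ℝ => w.1) (planeForm 1 0) v := by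
    simpa [planeForm] using (hasFDerivAt_fst : HasFDerivAt (𝕜 := ℝ) Prod.fst _ v)
  have := fderiv_nullVec (ε := ε) h0
    ((hasDerivAt_inv hv).hasFDerivAt_mul_planeForm (hasDerivAt_seProd μ v.2))
    (hasDerivAt_seX1 hμ v.2).hasFDerivAt_snd_planeForm
    (hasDerivAt_seX2 hμ v.2).hasFDerivAt_snd_planeForm a
  rw [show seNull μ ε = fun v => nullVec ε v.1 (v.1⁻¹ * seProd μ v.2) (seX1 μ v.2) (seX2 μ v.2)
    from rfl]
  simpa using this

theorem fderiv_fderiv_seNull {μ : ℝ} (hμ : 0 < μ) (ε : ℝ) {v : ℝ × ℝ} (hv : v.1 ≠ 0)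
    (a b : ℝ × ℝ) :
    fderiv ℝ (fun w => fderiv ℝ (seNull μ ε) w b) v a = nullVec ε 0
      ((2 * (v.1 ^ 3)⁻¹ * seProd μ v.2 * a.1 - (v.1 ^ 2)⁻¹ *
          (-2 * seConst μ ^ 2 * μ * (Real.cos (μ * v.2) * Real.sin (μ * v.2))) * a.2) * b.1 +
        (-(v.1 ^ 2)⁻¹ * (-2 * seConst μ ^ 2 * μ *
            (Real.cos (μ * v.2) * Real.sin (μ * v.2))) * a.1 +
          v.1⁻¹ * (-2 * seConst μ ^ 2 * μ ^ 2 *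
            (Real.cos (μ * v.2) ^ 2 - Real.sin (μ * v.2) ^ 2)) * a.2) * b.2)
      ((μ ^ 2 - 1) * seConst μ * Real.cos (μ * v.2) * Real.cos v.2 * a.2 * b.2)
      ((μ ^ 2 - 1) * seConst μ * Real.cos (μ * v.2) * Real.sin v.2 * a.2 * b.2) := by
  -- The formula for the first derivative holds on a neighbourhood of v, so it may be differentiated
  -- again.
  have hev : ∀ᶠ w : ℝ × ℝ in 𝓝 v, w.1 ≠ 0 :=
    continuous_fst.continuousAt.eventually_ne hv
  have heq : (fun w => fderiv ℝ (seNull μ ε) w b) =ᶠ[𝓝 v] _ :=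
    hev.mono fun w hw => fderiv_seNull hμ ε hw b
  have hsq : HasDerivAt (fun u : ℝ => -(u ^ 2)⁻¹) (2 * (v.1 ^ 3)⁻¹) v.1 := by
    refine ((hasDerivAt_pow 2 v.1).fun_inv (pow_ne_zero 2 hv)).fun_neg.congr_deriv ?_
    field_simp
    simp [mul_comm]
  rw [heq.fderiv_eq, fderiv_nullVec (hasFDerivAt_const_planeForm b.1 v)
    (((hsq.hasFDerivAt_mul_planeForm (hasDerivAt_seProd μ v.2)).const_mul_planeForm
      b.1).add_planeForm (((hasDerivAt_inv hv).hasFDerivAt_mul_planeForm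
        (hasDerivAt_deriv_seProd μ v.2)).const_mul_planeForm b.2))
    ((hasDerivAt_deriv_seX1 μ v.2).hasFDerivAt_snd_planeForm.const_mul_planeForm b.2)
    ((hasDerivAt_deriv_seX2 μ v.2).hasFDerivAt_snd_planeForm.const_mul_planeForm b.2)]
  congr 1 <;> ring

/-! ### Metric, normal and mean curvature in null coordinates. -/

theorem firstForm_seNull {μ : ℝ} (hμ : 0 < μ) {ε : ℝ} (hε : ε ^ 2 = 1) {v : ℝ × ℝ}
    (hv : v.1 ≠ 0) (a b : ℝ × ℝ) :
    firstForm (seNull μ ε) v a b = seConst μ ^ 2 *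
      ((Real.cos (μ * v.2) * a.1 / v.1 + μ * Real.sin (μ * v.2) * a.2) *
        (Real.cos (μ * v.2) * b.1 / v.1 + μ * Real.sin (μ * v.2) * b.2) +
        Real.cos (μ * v.2) ^ 2 * a.2 * b.2) := by
  have h := Real.sin_sq_add_cos_sq v.2
  rw [firstForm, fderiv_seNull hμ ε hv, fderiv_seNull hμ ε hv, minkowski_nullVec hε, seProd]
  set C := Real.cos (μ * v.2)
  set S := Real.sin (μ * v.2)
  field_simp
  linear_combination 2 * seConst μ ^ 2 * v.1 ^ 2 * a.2 * b.2 * (C ^ 2 + μ ^ 2 * S ^ 2) * h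

/-- The metric is c²((C dv₁/v₁ + μS dθ)² + C² dθ²) with C = cos(μθ), S = sin(μθ). At C = 0 only the
dθ² term survives, so the direction of the light-like line is null. -/
theorem lightlikeAt_seNull {μ : ℝ} (hμ : 0 < μ) {ε : ℝ} (hε : ε ^ 2 = 1) {v : ℝ × ℝ}
    (hv : v.1 ≠ 0) (hC : Real.cos (μ * v.2) = 0) : LightlikeAt (seNull μ ε) v := by
  constructor
  · intro a
    rw [firstForm_seNull hμ hε hv]
    have := mul_self_nonneg (Real.cos (μ * v.2) * a.1 / v.1 + μ * Real.sin (μ * v.2) * a.2)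
    have := sq_nonneg (Real.cos (μ * v.2) * a.2)
    exact mul_nonneg (sq_nonneg _) (by nlinarith)
  · exact ⟨(1, 0), by simp, by simp [firstForm_seNull hμ hε hv, hC]⟩

/-- The unit normal of the extension. -/
noncomputable def seNormal (μ ε : ℝ) (v : ℝ × ℝ) : Fin 4 → ℝ :=
  let c := seConst μ
  let C := Real.cos (μ * v.2)
  let S := Real.sin (μ * v.2)
  let E := c * C ^ 2 + μ * S ^ 2
  nullVec ε ((E + C ^ 2 / μ) * v.1 / (c * C ^ 2)) ((E + C ^ 2 / μ) * c / v.1)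
    (-E / C * Real.cos v.2 + S * Real.sin v.2) (-E / C * Real.sin v.2 - S * Real.cos v.2)

theorem seConst_relation {μ : ℝ} (hμ : 0 < μ) : 2 * seConst μ * μ = μ ^ 2 - 1 := by
  unfold seConst
  field_simp

theorem seX1_eq {μ : ℝ} (hμ : 0 < μ) (θ : ℝ) : seX1 μ θ =
    -(seConst μ + 1 / μ) * Real.cos (μ * θ) * Real.cos θ - Real.sin (μ * θ) * Real.sin θ := by
  unfold seX1 seConst
  field_simp
  ring

theorem seX2_eq {μ : ℝ} (hμ : 0 < μ) (θ : ℝ) : seX2 μ θ =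
    -(seConst μ + 1 / μ) * Real.cos (μ * θ) * Real.sin θ + Real.sin (μ * θ) * Real.cos θ := by
  unfold seX2 seConst
  field_simp
  ring

theorem isUnitNormal_seNormal {μ : ℝ} (hμ : 0 < μ) (hμ1 : μ ≠ 1) {ε : ℝ} (hε : ε ^ 2 = 1)
    {v : ℝ × ℝ} (hv : v.1 ≠ 0) (hC : Real.cos (μ * v.2) ≠ 0) :
    IsUnitNormal (seNull μ ε) v (seNormal μ ε v) := by
  have hc := seConst_ne_zero hμ hμ1
  have hr := seConst_relation hμ
  have h := Real.sin_sq_add_cos_sq v.2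
  have h2 := Real.sin_sq_add_cos_sq (μ * v.2)
  refine ⟨?_, ?_, fun a => ?_⟩
  · rw [seNormal, minkowski_nullVec hε]
    set C := Real.cos (μ * v.2)
    set S := Real.sin (μ * v.2)
    set c := seConst μ
    have e : -((c * C ^ 2 + μ * S ^ 2 + C ^ 2 / μ) * v.1 / (c * C ^ 2) *
        ((c * C ^ 2 + μ * S ^ 2 + C ^ 2 / μ) * c / v.1) +
        (c * C ^ 2 + μ * S ^ 2 + C ^ 2 / μ) * c / v.1 *
          ((c * C ^ 2 + μ * S ^ 2 + C ^ 2 / μ) * v.1 / (c * C ^ 2))) / 2 +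
        ((c * C ^ 2 + μ * S ^ 2) / C) ^ 2 + S ^ 2 = -(C ^ 2 * (2 * c * μ + 1) / μ ^ 2 + S ^ 2) := by
      field_simp
      ring
    -- Here 2cμ + 1 = μ², so the norm reduces to -(C² + S²) = -1.
    have e2 : C ^ 2 * (2 * c * μ + 1) / μ ^ 2 = C ^ 2 := by
      rw [hr]
      field_simp
      ring
    rw [e2] at e
    linear_combination e - h2 + (((c * C ^ 2 + μ * S ^ 2) / C) ^ 2 + S ^ 2) * h
  · rw [seNormal, seNull, minkowski_nullVec hε, seX1_eq hμ, seX2_eq hμ, seProd]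
    set C := Real.cos (μ * v.2)
    set S := Real.sin (μ * v.2)
    set c := seConst μ
    set E := c * C ^ 2 + μ * S ^ 2 with hE
    have e : -((E + C ^ 2 / μ) * v.1 / (c * C ^ 2) * (v.1⁻¹ * (c * C) ^ 2) +
        (E + C ^ 2 / μ) * c / v.1 * v.1) / 2 + E / C * ((c + 1 / μ) * C) - S ^ 2 = 0 := by
      rw [hE]
      field_simp
      ring
    linear_combination e + (E / C * ((c + 1 / μ) * C) - S ^ 2) * h
  · rw [seNormal, fderiv_seNull hμ ε hv, minkowski_nullVec hε, seProd]
    set C := Real.cos (μ * v.2)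
    set S := Real.sin (μ * v.2)
    set c := seConst μ
    set E := c * C ^ 2 + μ * S ^ 2 with hE
    have e : -((E + C ^ 2 / μ) * v.1 / (c * C ^ 2) * (-(v.1 ^ 2)⁻¹ * (c * C) ^ 2 * a.1 +
        v.1⁻¹ * (-2 * c ^ 2 * μ * (C * S)) * a.2) + (E + C ^ 2 / μ) * c / v.1 * a.1) / 2 +
        (-E / C * (c * μ * S) - S * c * C) * a.2 = 0 := by
      rw [hE]
      field_simp
      ring
    linear_combination e + (-E / C * (c * μ * S) - S * c * C) * a.2 * h

theorem secondForm_seNull {μ : ℝ} (hμ : 0 < μ) (hμ1 : μ ≠ 1) {ε : ℝ} (hε : ε ^ 2 = 1)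
    {v : ℝ × ℝ} (hv : v.1 ≠ 0) (hC : Real.cos (μ * v.2) ≠ 0) (a b : ℝ × ℝ) :
    let c := seConst μ
    let C := Real.cos (μ * v.2)
    let S := Real.sin (μ * v.2)
    let E := c * C ^ 2 + μ * S ^ 2
    secondForm (seNull μ ε) v (seNormal μ ε v) a b =
      -(E + C ^ 2 / μ) * c * (a.1 * b.1 / v.1 ^ 2 + μ * S / (C * v.1) * (a.1 * b.2 + a.2 * b.1) -
        μ ^ 2 * (C ^ 2 - S ^ 2) / C ^ 2 * a.2 * b.2) - (μ ^ 2 - 1) * c * E * a.2 * b.2 := by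
  have hc := seConst_ne_zero hμ hμ1
  have h := Real.sin_sq_add_cos_sq v.2
  intro c C S E
  have hcd : c = seConst μ := rfl
  have hCd : C = Real.cos (μ * v.2) := rfl
  have hSd : S = Real.sin (μ * v.2) := rfl
  rw [secondForm, fderiv_fderiv_seNull hμ ε hv, seNormal, minkowski_nullVec hε, seProd]
  simp only [← hcd, ← hCd, ← hSd] at hc hC ⊢
  change _ + _ * (-E / C * _ + _) + _ * (-E / C * _ - _) = _
  have e : -(0 * ((E + C ^ 2 / μ) * c / v.1) + ((2 * (v.1 ^ 3)⁻¹ * (c * C) ^ 2 * a.1 -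
      (v.1 ^ 2)⁻¹ * (-2 * c ^ 2 * μ * (C * S)) * a.2) * b.1 +
      (-(v.1 ^ 2)⁻¹ * (-2 * c ^ 2 * μ * (C * S)) * a.1 +
      v.1⁻¹ * (-2 * c ^ 2 * μ ^ 2 * (C ^ 2 - S ^ 2)) * a.2) * b.2) *
      ((E + C ^ 2 / μ) * v.1 / (c * C ^ 2))) / 2 =
      -(E + C ^ 2 / μ) * c * (a.1 * b.1 / v.1 ^ 2 + μ * S / (C * v.1) * (a.1 * b.2 + a.2 * b.1) -
        μ ^ 2 * (C ^ 2 - S ^ 2) / C ^ 2 * a.2 * b.2) := by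
    field_simp
    ring
  have e2 : E / C * C = E := div_mul_cancel₀ _ hC
  linear_combination e - (μ ^ 2 - 1) * c * a.2 * b.2 * (E / C * C) * h -
    (μ ^ 2 - 1) * c * a.2 * b.2 * e2

theorem spacelikeCMC1At_seNull {μ : ℝ} (hμ : 0 < μ) (hμ1 : μ ≠ 1) {ε : ℝ} (hε : ε ^ 2 = 1)
    {v : ℝ × ℝ} (hv : v.1 ≠ 0) (hC : Real.cos (μ * v.2) ≠ 0) :
    SpacelikeCMC1At (seNull μ ε) v := by
  have hc := seConst_ne_zero hμ hμ1
  refine ⟨fun a ha => ?_, seNormal μ ε v, isUnitNormal_seNormal hμ hμ1 hε hv hC, ?_⟩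
  · rw [firstForm_seNull hμ hε hv]
    refine mul_pos (by positivity) ?_
    by_cases ha2 : a.2 = 0
    · have ha1 : a.1 ≠ 0 := fun h => ha (Prod.ext h ha2)
      rw [ha2]
      have : Real.cos (μ * v.2) * a.1 / v.1 ≠ 0 := div_ne_zero (mul_ne_zero hC ha1) hv
      have := mul_self_pos.2 this
      simpa using this
    · have h1 := mul_self_nonneg (Real.cos (μ * v.2) * a.1 / v.1 + μ * Real.sin (μ * v.2) * a.2)
      have h2 : 0 < Real.cos (μ * v.2) ^ 2 * a.2 * a.2 := by
        rw [mul_assoc]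
        exact mul_pos (by positivity) (mul_self_pos.2 ha2)
      linarith
  · have hr := seConst_relation hμ
    simp only [meanCurvature, firstForm_seNull hμ hε hv, secondForm_seNull hμ hμ1 hε hv hC]
    set C := Real.cos (μ * v.2)
    set S := Real.sin (μ * v.2)
    set c := seConst μ
    rw [div_eq_one_iff_eq]
    · field_simp
      -- Once denominators are cleared, mean curvature one is a multiple of the relation 2cμ = μ² -
      -- 1.
      linear_combination -(C ^ 6 * v.1 ^ 2) * hr
    -- The denominator of the mean curvature is twice the Gram determinant, 2c⁴C⁴/v₁².
    · have e : 2 * (c ^ 2 * ((C * 1 / v.1 + μ * S * 0) * (C * 1 / v.1 + μ * S * 0) +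
          C ^ 2 * 0 * 0) * (c ^ 2 * ((C * 0 / v.1 + μ * S * 1) * (C * 0 / v.1 + μ * S * 1) +
          C ^ 2 * 1 * 1)) - (c ^ 2 * ((C * 1 / v.1 + μ * S * 0) * (C * 0 / v.1 + μ * S * 1) +
          C ^ 2 * 0 * 1)) ^ 2) = 2 * c ^ 4 * C ^ 4 / v.1 ^ 2 := by
        field_simp
        ring
      rw [e]
      positivity

/-! ### Local parametrizations of the regular part of the surface -/

theorem continuous_seSurface_apply {μ : ℝ} (i : Fin 3) : Continuous fun p : seSurface μ => p.1 i :=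
  (continuous_apply i).comp continuous_subtype_val

/-- The parametrization by `(ξ, θ)` (for `true`) or by `(η, θ)` (for `false`). -/
noncomputable def seParamFun (μ : ℝ) (b : Bool) (v : ℝ × ℝ) : Fin 3 → ℝ :=
  bif b then ![v.1, v.1⁻¹ * seProd μ v.2, v.2] else ![v.1⁻¹ * seProd μ v.2, v.1, v.2]

theorem seParamFun_mem {μ : ℝ} (b : Bool) {v : ℝ × ℝ} (hv : v.1 ≠ 0) :
    seParamFun μ b v ∈ seSurface μ := by
  rw [mem_seSurface, ← seProd]
  cases b
  · simp [seParamFun]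
    field_simp
  · simp [seParamFun]
    field_simp

theorem mem_seSurface_vertex {μ : ℝ} (hμ : 0 < μ) :
    (![0, 0, seAngle μ 0] : Fin 3 → ℝ) ∈ seSurface μ := by
  have := (cos_mul_eq_zero_iff hμ).2 ⟨0, rfl⟩
  simp [mem_seSurface, this]

theorem contDiff_seProd (μ : ℝ) {n : WithTop ℕ∞} : ContDiff ℝ n (seProd μ) := by
  unfold seProd
  have := Real.contDiff_cos (n := n)
  fun_prop

theorem analyticOnNhd_seParamFun (μ : ℝ) (b : Bool) :
    AnalyticOnNhd ℝ (seParamFun μ b) {v | v.1 ≠ 0} := by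
  have h1 : AnalyticOnNhd ℝ (fun v : ℝ × ℝ => v.1) {v | v.1 ≠ 0} := analyticOnNhd_fst
  have h2 : AnalyticOnNhd ℝ (fun v : ℝ × ℝ => v.2) {v | v.1 ≠ 0} := analyticOnNhd_snd
  have h3 : AnalyticOnNhd ℝ (fun v : ℝ × ℝ => v.1⁻¹ * seProd μ v.2) {v | v.1 ≠ 0} := fun v hv =>
    ((h1 v hv).inv hv).mul (((contDiff_seProd μ).analyticAt_of_omega _).comp
      (f := fun v : ℝ × ℝ => v.2) (h2 v hv))
  cases b
  · exact analyticOnNhd_pi_three h3 h1 h2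
  · exact analyticOnNhd_pi_three h1 h3 h2

/-- The index of the coordinate `ξ` or `η`. -/
def seIndex (b : Bool) : Fin 3 := bif b then 0 else 1

open Classical in
/-- The local parametrization by `(ξ, θ)` or by `(η, θ)`. -/
noncomputable def seParam {μ : ℝ} (hμ : 0 < μ) (b : Bool) :
    OpenPartialHomeomorph (ℝ × ℝ) (seSurface μ) where
  -- Off the source the value is irrelevant; the vertex over θ₀ serves as a default.
  toFun v := if h : v.1 ≠ 0 then ⟨seParamFun μ b v, seParamFun_mem b h⟩ else
    ⟨_, mem_seSurface_vertex hμ⟩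
  invFun p := (p.1 (seIndex b), p.1 2)
  source := {v | v.1 ≠ 0}
  target := {p | p.1 (seIndex b) ≠ 0}
  map_source' v hv := by
    have hv' : v.1 ≠ 0 := hv
    cases b <;> simp [hv', seParamFun, seIndex]
  map_target' p hp := hp
  left_inv' v hv := by
    have hv' : v.1 ≠ 0 := hv
    cases b <;> simp [hv', seParamFun, seIndex]
  right_inv' p hp := by
    have hp' : p.1 (seIndex b) ≠ 0 := hp
    have h := mem_seSurface.1 p.2
    rw [← seProd] at h
    ext i
    cases b
    · simp only [seIndex, cond_false] at hp'
      fin_cases i <;> simp [hp', seParamFun, seIndex]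
      rw [← h]
      field_simp
    · simp only [seIndex, cond_true] at hp'
      fin_cases i <;> simp [hp', seParamFun, seIndex]
      rw [← h]
      field_simp
  open_source := isOpen_ne_fun continuous_fst continuous_const
  open_target := isOpen_ne_fun (continuous_seSurface_apply _) continuous_const
  continuousOn_toFun := by
    refine Topology.IsInducing.subtypeVal.continuousOn_iff.2 ?_
    refine (analyticOnNhd_seParamFun μ b).continuousOn.congr fun v hv => ?_
    have hv' : v.1 ≠ 0 := hv
    simp [hv']
  continuousOn_invFun :=
    ((continuous_seSurface_apply _).prodMk (continuous_seSurface_apply _)).continuousOn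

theorem seParam_coe {μ : ℝ} (hμ : 0 < μ) (b : Bool) {v : ℝ × ℝ} (hv : v.1 ≠ 0) :
    (seParam hμ b v).1 = seParamFun μ b v := by
  simp [seParam, hv]

/-- A map with a differentiable local left inverse is an immersion. -/
theorem injective_fderiv_of_leftInverse {E F : Type*} [NormedAddCommGroup E] [NormedSpace ℝ E]
    [NormedAddCommGroup F] [NormedSpace ℝ F] {f : E → F} {g : F → E} {x : E}
    (hf : DifferentiableAt ℝ f x) (hg : DifferentiableAt ℝ g (f x)) (h : g ∘ f =ᶠ[𝓝 x] id) :
    Function.Injective (fderiv ℝ f x) := by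
  have h1 := h.fderiv_eq (𝕜 := ℝ)
  rw [fderiv_comp x hg hf, fderiv_id] at h1
  exact Function.LeftInverse.injective (g := fderiv ℝ g (f x)) fun v => congrArg (fun L => L v) h1

theorem isLocalParam_seParam {μ : ℝ} (hμ : 0 < μ) (hμ1 : μ ≠ 1) (b : Bool) :
    (seDCStructure hμ hμ1).IsLocalParam (seParam hμ b) := by
  rintro _ ⟨k, rfl⟩ v hv hk
  have hv' : v.1 ≠ 0 := hv
  have hk' : (seParam hμ b v).1 ∈ seSlab μ k := hk
  have hev : ∀ᶠ w : ℝ × ℝ in 𝓝 v, w.1 ≠ 0 := continuous_fst.continuousAt.eventually_ne hv'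
  have heq : (fun w => (seChart hμ hμ1 k (seParam hμ b w)).1) =ᶠ[𝓝 v]
      fun w => seChartFun μ k (seParamFun μ b w) := hev.mono fun w hw => by
    change seChartFun μ k (seParam hμ b w).1 = _
    rw [seParam_coe hμ b hw]
  rw [seParam_coe hμ b hv'] at hk'
  have hpa := analyticOnNhd_seParamFun μ b v hv'
  have ha : AnalyticAt ℝ (fun w => seChartFun μ k (seParamFun μ b w)) v :=
    (analyticOnNhd_seChartFun μ k _ hk').comp hpa
  refine ⟨?_, ha.congr heq.symm, ?_⟩
  · intro h0
    have := (seChartFun_eq_zero_iff hμ hμ1 (seParam hμ b v).2).1 h0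
    rw [seParam_coe hμ b hv'] at this
    cases b
    · exact hv' this.2
    · exact hv' this.1
  · rw [heq.fderiv_eq]
    -- Undoing the chart and reading off two of the three coordinates is a left inverse.
    have hinv : AnalyticAt ℝ (fun a => (seChartInv μ k a (seIndex b), seChartInv μ k a 2))
        (seChartFun μ k (seParamFun μ b v)) :=
      ((analyticOnNhd_eval (seIndex b) univ).comp (analyticOnNhd_seChartInv μ k univ)
        (mapsTo_univ _ _) _ (mem_univ _)).prod ((analyticOnNhd_eval 2 univ).comp
          (analyticOnNhd_seChartInv μ k univ) (mapsTo_univ _ _) _ (mem_univ _))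
    refine injective_fderiv_of_leftInverse ha.differentiableAt hinv.differentiableAt ?_
    filter_upwards [hpa.continuousAt.preimage_mem_nhds ((isOpen_seSlab μ k).mem_nhds hk')]
      with w hw
    simp only [Function.comp, seChartInv_seChartFun hμ hμ1 k hw]
    cases b <;> rfl

/-! ### Transfer of the local computations to the surface. -/

theorem Filter.EventuallyEq.firstForm_eq {F G : ℝ × ℝ → Fin 4 → ℝ} {v : ℝ × ℝ} (h : F =ᶠ[𝓝 v] G) :
    firstForm F v = firstForm G v := by
  ext a b
  simp only [firstForm, h.fderiv_eq]

theorem Filter.EventuallyEq.secondForm_eq {F G : ℝ × ℝ → Fin 4 → ℝ} {v : ℝ × ℝ} (h : F =ᶠ[𝓝 v] G)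
    (ν : Fin 4 → ℝ) : secondForm F v ν = secondForm G v ν := by
  ext a b
  have : (fun w => fderiv ℝ F w b) =ᶠ[𝓝 v] fun w => fderiv ℝ G w b :=
    (h.fderiv (𝕜 := ℝ)).mono fun w hw => by simp only [hw]
  simp only [secondForm, this.fderiv_eq]

theorem SpacelikeCMC1At.congr {F G : ℝ × ℝ → Fin 4 → ℝ} {v : ℝ × ℝ} (hF : SpacelikeCMC1At F v)
    (h : F =ᶠ[𝓝 v] G) : SpacelikeCMC1At G v := by
  obtain ⟨h1, ν, ⟨hn1, hn2, hn3⟩, h2⟩ := hF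
  refine ⟨fun a ha => h.firstForm_eq ▸ h1 a ha, ν, ⟨hn1, h.eq_of_nhds ▸ hn2, fun a => ?_⟩, ?_⟩
  · rw [← h.fderiv_eq]
    exact hn3 a
  · rw [← h2, meanCurvature, meanCurvature, h.firstForm_eq, h.secondForm_eq]

theorem LightlikeAt.congr {F G : ℝ × ℝ → Fin 4 → ℝ} {v : ℝ × ℝ} (hF : LightlikeAt F v)
    (h : F =ᶠ[𝓝 v] G) : LightlikeAt G v := by
  unfold LightlikeAt at hF ⊢
  rwa [← h.firstForm_eq]

/-- The sign of the `x₃`-coordinate of `ξ` or `η`. -/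
def seSign (b : Bool) : ℝ := bif b then 1 else -1

theorem seSign_sq (b : Bool) : seSign b ^ 2 = 1 := by
  cases b <;> simp [seSign]

theorem seExtension_seParam {μ : ℝ} (hμ : 0 < μ) (b : Bool) {v : ℝ × ℝ} (hv : v.1 ≠ 0) :
    seExtension μ (seParam hμ b v) = seNull μ (seSign b) v := by
  rw [seExtension, seParam_coe hμ b hv]
  ext i
  cases b <;> fin_cases i <;> simp [seParamFun, seNull, nullVec, seSign]
  ring

theorem seNull_eventuallyEq {μ : ℝ} (hμ : 0 < μ) (b : Bool) {v : ℝ × ℝ} (hv : v.1 ≠ 0) :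
    seNull μ (seSign b) =ᶠ[𝓝 v] fun w => seExtension μ (seParam hμ b w) :=
  (continuous_fst.continuousAt.eventually_ne hv).mono fun _ hw => (seExtension_seParam hμ b hw).symm

theorem exists_seParam {μ : ℝ} (hμ : 0 < μ) {p : seSurface μ} (hp : ¬(p.1 0 = 0 ∧ p.1 1 = 0)) :
    ∃ (b : Bool) (v : ℝ × ℝ), v ∈ (seParam hμ b).source ∧ seParam hμ b v = p ∧ v.2 = p.1 2 := by
  have : ∃ b, p ∈ (seParam hμ b).target := by
    by_cases h : p.1 0 = 0
    · exact ⟨false, fun h1 => hp ⟨h, h1⟩⟩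
    · exact ⟨true, h⟩
  obtain ⟨b, hb⟩ := this
  exact ⟨b, (seParam hμ b).symm p, (seParam hμ b).map_target hb, (seParam hμ b).right_inv hb, rfl⟩

theorem isSpacelikeCMC1At_seExtension {μ : ℝ} (hμ : 0 < μ) (hμ1 : μ ≠ 1) {p : seSurface μ}
    (hp : Real.cos (μ * p.1 2) ≠ 0) :
    (seDCStructure hμ hμ1).IsSpacelikeCMC1At (seExtension μ) p := by
  have hp0 : ¬(p.1 0 = 0 ∧ p.1 1 = 0) := by
    rintro ⟨h0, -⟩
    have := mem_seSurface.1 p.2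
    rw [h0, zero_mul] at this
    have := pow_eq_zero_iff (two_ne_zero) |>.1 this.symm
    exact mul_ne_zero (seConst_ne_zero hμ hμ1) hp this
  obtain ⟨b, v, hv, rfl, hv2⟩ := exists_seParam hμ hp0
  rw [← hv2] at hp
  exact ⟨seParam hμ b, isLocalParam_seParam hμ hμ1 b, v, hv, rfl,
    (spacelikeCMC1At_seNull hμ hμ1 (seSign_sq b) hv hp).congr (seNull_eventuallyEq hμ b hv)⟩

theorem isLightlikeAt_seExtension {μ : ℝ} (hμ : 0 < μ) (hμ1 : μ ≠ 1) {p : seSurface μ}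
    (hp : Real.cos (μ * p.1 2) = 0) (hp0 : ¬(p.1 0 = 0 ∧ p.1 1 = 0)) :
    (seDCStructure hμ hμ1).IsLightlikeAt (seExtension μ) p := by
  obtain ⟨b, v, hv, rfl, hv2⟩ := exists_seParam hμ hp0
  rw [← hv2] at hp
  exact ⟨seParam hμ b, isLocalParam_seParam hμ hμ1 b, v, hv, rfl,
    (lightlikeAt_seNull hμ (seSign_sq b) hv hp).congr (seNull_eventuallyEq hμ b hv)⟩

/-! ### Connectedness of the surface and density of its space-like part -/

/-- The parametrization of the half `σ (ξ + η) ≥ 0` of the surface by `((ξ - η)/2, θ)`. -/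
noncomputable def seHalf (μ σ : ℝ) (v : ℝ × ℝ) : Fin 3 → ℝ :=
  ![σ * Real.sqrt (v.1 ^ 2 + seProd μ v.2) + v.1, σ * Real.sqrt (v.1 ^ 2 + seProd μ v.2) - v.1, v.2]

theorem seProd_nonneg (μ θ : ℝ) : 0 ≤ seProd μ θ := sq_nonneg _

theorem seHalf_mem {μ σ : ℝ} (hσ : σ ^ 2 = 1) (v : ℝ × ℝ) : seHalf μ σ v ∈ seSurface μ := by
  have h := Real.sq_sqrt (add_nonneg (sq_nonneg v.1) (seProd_nonneg μ v.2))
  rw [mem_seSurface, ← seProd]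
  simp only [seHalf, Matrix.cons_val]
  linear_combination Real.sqrt (v.1 ^ 2 + seProd μ v.2) ^ 2 * hσ + h

theorem continuous_seHalf (μ σ : ℝ) : Continuous (seHalf μ σ) := by
  have h : Continuous (seProd μ) := (contDiff_seProd μ (n := 0)).continuous
  unfold seHalf
  fun_prop

theorem exists_seHalf_eq {μ : ℝ} (p : seSurface μ) :
    ∃ σ : ℝ, σ ^ 2 = 1 ∧ seHalf μ σ ((p.1 0 - p.1 1) / 2, p.1 2) = p.1 := by
  have h := mem_seSurface.1 p.2
  rw [← seProd] at h
  have hs : ((p.1 0 - p.1 1) / 2) ^ 2 + seProd μ (p.1 2) = ((p.1 0 + p.1 1) / 2) ^ 2 := by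
    rw [← h]; ring
  rcases le_total 0 ((p.1 0 + p.1 1) / 2) with h0 | h0
  · refine ⟨1, by norm_num, ?_⟩
    have hr : Real.sqrt (((p.1 0 - p.1 1) / 2) ^ 2 + seProd μ (p.1 2)) = (p.1 0 + p.1 1) / 2 := by
      rw [hs, Real.sqrt_sq h0]
    ext i
    fin_cases i <;> simp only [seHalf, hr] <;> simp <;> ring
  · refine ⟨-1, by norm_num, ?_⟩
    have hr : Real.sqrt (((p.1 0 - p.1 1) / 2) ^ 2 + seProd μ (p.1 2)) = -((p.1 0 + p.1 1) / 2) := by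
      rw [hs, Real.sqrt_sq_eq_abs, abs_of_nonpos h0]
    ext i
    fin_cases i <;> simp only [seHalf, hr] <;> simp <;> ring

/-- The halves ξ + η ≥ 0 and ξ + η ≤ 0 are continuous images of the plane that meet at a DC-point.
-/
theorem connectedSpace_seSurface {μ : ℝ} (hμ : 0 < μ) : ConnectedSpace (seSurface μ) := by
  have hr : ∀ σ, IsPreconnected (range (seHalf μ σ)) := fun σ =>
    isPreconnected_range (continuous_seHalf μ σ)
  have hv : ∀ σ, (![0, 0, seAngle μ 0] : Fin 3 → ℝ) ∈ range (seHalf μ σ) := fun σ => by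
    have := (cos_mul_eq_zero_iff hμ).2 ⟨0, rfl⟩
    exact ⟨(0, seAngle μ 0), by simp [seHalf, seProd, this]⟩
  have hu : seSurface μ = range (seHalf μ 1) ∪ range (seHalf μ (-1)) := by
    ext p
    constructor
    · intro hp
      obtain ⟨σ, hσ, h⟩ := exists_seHalf_eq ⟨p, hp⟩
      rcases mul_self_eq_one_iff.1 ((sq σ).symm.trans hσ) with rfl | rfl
      · exact Or.inl ⟨_, h⟩
      · exact Or.inr ⟨_, h⟩
    · rintro (⟨v, rfl⟩ | ⟨v, rfl⟩)
      · exact seHalf_mem (by norm_num) v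
      · exact seHalf_mem (by norm_num) v
  have hc : IsConnected (seSurface μ) := by
    refine ⟨⟨_, mem_seSurface_vertex hμ⟩, ?_⟩
    rw [hu]
    exact (hr 1).union _ (hv 1) (hv (-1)) (hr (-1))
  exact isConnected_iff_connectedSpace.1 hc

theorem eventually_cos_mul_ne_zero {μ : ℝ} (hμ : 0 < μ) (θ : ℝ) :
    ∀ᶠ t in 𝓝[≠] θ, Real.cos (μ * t) ≠ 0 := by
  by_cases h : Real.cos (μ * θ) = 0
  · have h2 := Real.sin_sq_add_cos_sq (μ * θ)
    have hs : Real.sin (μ * θ) ≠ 0 := fun h0 => by simp [h, h0] at h2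
    exact (hasDerivAt_mul_left_id μ θ).cos.eventually_ne
      (mul_ne_zero (neg_ne_zero.2 hs) hμ.ne')
  · have : ContinuousAt (fun t => Real.cos (μ * t)) θ := by fun_prop
    exact (this.eventually_ne h).filter_mono nhdsWithin_le_nhds

/-- With the half and (ξ - η)/2 kept fixed, θ can still be moved freely, and the zeros of cos(μθ)
are isolated. -/
theorem dense_cos_ne_zero {μ : ℝ} (hμ : 0 < μ) :
    Dense {p : seSurface μ | Real.cos (μ * p.1 2) ≠ 0} := by
  intro p
  obtain ⟨σ, hσ, h⟩ := exists_seHalf_eq p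
  let q : ℝ → seSurface μ := fun t => ⟨seHalf μ σ ((p.1 0 - p.1 1) / 2, t), seHalf_mem hσ _⟩
  have hq : Continuous q :=
    ((continuous_seHalf μ σ).comp (by fun_prop)).subtype_mk _
  have hqp : q (p.1 2) = p := Subtype.ext h
  refine mem_closure_of_tendsto (b := 𝓝[≠] (p.1 2)) (f := q) ?_ ?_
  · have := hq.continuousAt (x := p.1 2)
    rw [ContinuousAt, hqp] at this
    exact this.mono_left nhdsWithin_le_nhds
  · exact eventually_cos_mul_ne_zero hμ _

theorem isSpacelikeCMC1DCImmersion_seExtension {μ : ℝ} (hμ : 0 < μ) (hμ1 : μ ≠ 1) :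
    (seDCStructure hμ hμ1).IsSpacelikeCMC1DCImmersion (seExtension μ) := by
  refine ⟨connectedSpace_seSurface hμ, isDCImmersion_seExtension hμ hμ1, fun p hp => ?_,
    {p | Real.cos (μ * p.1 2) ≠ 0}, isOpen_ne_fun
      (Real.continuous_cos.comp (continuous_const.mul (continuous_seSurface_apply 2)))
      continuous_const,
    dense_cos_ne_zero hμ, fun p hp => isSpacelikeCMC1At_seExtension hμ hμ1 hp⟩
  rw [dcPoints_seDCStructure] at hp
  by_cases h : Real.cos (μ * p.1 2) = 0
  · exact Or.inr (isLightlikeAt_seExtension hμ hμ1 h hp)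
  · exact Or.inl (isSpacelikeCMC1At_seExtension hμ hμ1 h)

/-! ### The image of the extension -/

theorem seExtension_mem_seLimitSet {μ : ℝ} (hμ : 0 < μ) {p : seSurface μ}
    (hp : Real.cos (μ * p.1 2) = 0) : seExtension μ p ∈ seLimitSet μ := by
  obtain ⟨k, hk⟩ := (cos_mul_eq_zero_iff hμ).1 hp
  have h := mem_seSurface.1 p.2
  rw [hp, mul_zero, zero_pow two_ne_zero] at h
  rw [seAngle] at hk
  refine ⟨k, (p.1 0 + p.1 1) / 2, ?_⟩
  rw [← hk, seExtension]
  rcases mul_eq_zero.1 h with h | h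
  · right
    rw [h]
    ring_nf
  · left
    rw [h]
    ring_nf

/-- The profile `p(θ)` of the catenoid. -/
noncomputable def seProfile (μ θ : ℝ) : ℝ := -seConst μ * Real.cos (μ * θ)

theorem seProfile_sq (μ θ : ℝ) : seProfile μ θ ^ 2 = seProd μ θ := by
  unfold seProfile seProd
  ring

/-- The factorization of the catenoid through the surface. -/
noncomputable def seLift (μ : ℝ) (v : ℝ × ℝ) : seSurface μ :=
  ⟨![seProfile μ v.2 * Real.exp v.1, seProfile μ v.2 * Real.exp (-v.1), v.2], by
    rw [mem_seSurface, ← seProd, ← seProfile_sq]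
    have : Real.exp v.1 * Real.exp (-v.1) = 1 := by rw [← Real.exp_add]; simp
    simp only [Matrix.cons_val]
    linear_combination seProfile μ v.2 ^ 2 * this⟩

theorem seCatenoid_eq (μ : ℝ) (v : ℝ × ℝ) : seCatenoid μ v = seExtension μ (seLift μ v) := by
  ext i
  fin_cases i <;> simp [seCatenoid, seExtension, seLift, seProfile, seConst, Real.cosh_eq,
    Real.sinh_eq] <;> ring

theorem analyticOnNhd_seLift (μ : ℝ) :
    AnalyticOnNhd ℝ (fun v => (seLift μ v).1) univ := by
  have he := Real.contDiff_exp (n := ⊤)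
  have hc := Real.contDiff_cos (n := ⊤)
  have h1 : ContDiff ℝ ⊤ (fun v : ℝ × ℝ => seProfile μ v.2 * Real.exp v.1) := by
    unfold seProfile; fun_prop
  have h2 : ContDiff ℝ ⊤ (fun v : ℝ × ℝ => seProfile μ v.2 * Real.exp (-v.1)) := by
    unfold seProfile; fun_prop
  exact analyticOnNhd_pi_three (fun v _ => h1.analyticAt_of_omega v)
    (fun v _ => h2.analyticAt_of_omega v) analyticOnNhd_snd

theorem isDCAnalyticFrom_seLift {μ : ℝ} (hμ : 0 < μ) (hμ1 : μ ≠ 1) :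
    (seDCStructure hμ hμ1).IsDCAnalyticFrom (seLift μ) := by
  refine ⟨Topology.IsInducing.subtypeVal.continuous_iff.2
    (continuousOn_univ.1 (analyticOnNhd_seLift μ).continuousOn), ?_⟩
  rintro _ ⟨k, rfl⟩
  exact (analyticOnNhd_seChartFun μ k).comp ((analyticOnNhd_seLift μ).mono (subset_univ _))
    fun v hv => hv

theorem range_seExtension {μ : ℝ} (hμ : 0 < μ) (hμ1 : μ ≠ 1) :
    range (seExtension μ) =
      range (seCatenoid μ) ∪ seLimitSet μ ∪ seReflection '' range (seCatenoid μ) := by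
  apply Subset.antisymm
  · rintro _ ⟨p, rfl⟩
    by_cases hC : Real.cos (μ * p.1 2) = 0
    · exact Or.inl (Or.inr (seExtension_mem_seLimitSet hμ hC))
    have hP : seProfile μ (p.1 2) ≠ 0 :=
      mul_ne_zero (neg_ne_zero.2 (seConst_ne_zero hμ hμ1)) hC
    have h := mem_seSurface.1 p.2
    rw [← seProd, ← seProfile_sq] at h
    have h0 : p.1 0 ≠ 0 := fun h0 => by
      rw [h0, zero_mul] at h
      exact hP (pow_eq_zero_iff two_ne_zero |>.1 h.symm)
    -- τ is the sign of ξ/p. Then τξ/p = eˢ defines s, and τη/p = e⁻ˢ follows from ξη = p²; the case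
    -- τ = -1 is the reflected catenoid.
    have key : ∀ τ : ℝ, τ ^ 2 = 1 → 0 < τ * p.1 0 / seProfile μ (p.1 2) → ∃ v : ℝ × ℝ,
        (seLift μ v).1 = ![τ * p.1 0, τ * p.1 1, p.1 2] := by
      intro τ hτ hpos
      have hτ0 : τ ≠ 0 := fun h => by norm_num [h] at hτ
      refine ⟨(Real.log (τ * p.1 0 / seProfile μ (p.1 2)), p.1 2), ?_⟩
      simp only [seLift, Real.exp_neg, Real.exp_log hpos]
      ext i
      fin_cases i
      · simp
        field_simp
      · simp
        field_simp
        linear_combination -h + p.1 0 * p.1 1 * -hτ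
      · simp
    rcases lt_or_gt_of_ne (div_ne_zero h0 hP) with hlt | hgt
    · obtain ⟨v, hv⟩ := key (-1) (by norm_num) (by rw [mul_div_assoc]; linarith)
      refine Or.inr ⟨_, ⟨v, rfl⟩, ?_⟩
      rw [seCatenoid_eq, seExtension, hv]
      ext i
      fin_cases i <;> simp [seReflection, seExtension] <;> ring
    · obtain ⟨v, hv⟩ := key 1 (by norm_num) (by rwa [one_mul])
      refine Or.inl (Or.inl ⟨v, ?_⟩)
      rw [seCatenoid_eq, seExtension, hv]
      simp [seExtension]
  · rintro _ ((⟨v, rfl⟩ | ⟨k, u, h⟩) | ⟨_, ⟨v, rfl⟩, rfl⟩)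
    · exact ⟨_, (seCatenoid_eq μ v).symm⟩
    · have hC : Real.cos (μ * seAngle μ k) = 0 := (cos_mul_eq_zero_iff hμ).2 ⟨k, rfl⟩
      rcases h with rfl | rfl
      · refine ⟨⟨![2 * u, 0, seAngle μ k], by simp [mem_seSurface, hC]⟩, ?_⟩
        simp [seExtension, seAngle]
      · refine ⟨⟨![0, 2 * u, seAngle μ k], by simp [mem_seSurface, hC]⟩, ?_⟩
        simp [seExtension, seAngle, neg_div]
    · refine ⟨⟨![-(seLift μ v).1 0, -(seLift μ v).1 1, (seLift μ v).1 2], ?_⟩, ?_⟩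
      · have := mem_seSurface.1 (seLift μ v).2
        simpa [mem_seSurface] using this
      · rw [seCatenoid_eq]
        ext i
        fin_cases i <;> simp [seReflection, seExtension] <;> ring

theorem isAnalyticExtension_seExtension {μ : ℝ} (hμ : 0 < μ) (hμ1 : μ ≠ 1) :
    (seDCStructure hμ hμ1).IsAnalyticExtension deSitter (seCatenoid μ) (seExtension μ) := by
  have hfun : seCatenoid μ = seExtension μ ∘ seLift μ := funext (seCatenoid_eq μ)
  refine ⟨?_, fun v => ?_, isDCAnalytic_seExtension hμ hμ1,
    ⟨seLift μ, isDCAnalyticFrom_seLift hμ hμ1, hfun⟩, ?_, ?_⟩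
  · rw [hfun]
    exact (analyticOnNhd_seAmbient μ).comp (analyticOnNhd_seLift μ) (mapsTo_univ _ _)
  · rw [seCatenoid_eq]
    exact seExtension_mem hμ _
  · rw [hfun]
    exact range_comp_subset_range _ _
  · intro hsub
    have hC : Real.cos (μ * seAngle μ 0) = 0 := (cos_mul_eq_zero_iff hμ).2 ⟨0, rfl⟩
    -- On the catenoid ξ = p eˢ and η = p e⁻ˢ vanish together, so a point with ξ = 1, η = 0 is
    -- missed.
    obtain ⟨v, hv⟩ := hsub ⟨⟨![1, 0, seAngle μ 0], by simp [mem_seSurface, hC]⟩, rfl⟩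
    rw [seCatenoid_eq] at hv
    have e0 := congrFun hv 0
    have e3 := congrFun hv 3
    simp only [seExtension, seLift, Matrix.cons_val] at e0 e3
    have h1 : seProfile μ v.2 * Real.exp v.1 = 1 := by linarith
    have h2 : seProfile μ v.2 * Real.exp (-v.1) = 0 := by linarith
    have h3 := (mul_eq_zero.1 h2).resolve_right (Real.exp_pos _).ne'
    rw [h3, zero_mul] at h1
    exact zero_ne_one h1

/-! ### Arc-properness -/

/-- A curve of angles along which `cos² (μθ)` converges has a limit point. -/
theorem exists_tendsto_of_tendsto_cos_sq {μ : ℝ} (hμ : 0 < μ) {θ : ℝ → ℝ} {κ : ℝ}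
    (hθ : ContinuousOn θ (Ioo 0 1))
    (hκ : Tendsto (fun t => Real.cos (μ * θ t) ^ 2) (𝓝[<] 1) (𝓝 κ)) :
    ∃ (t : ℕ → ℝ) (θ₁ : ℝ), (∀ k, t k ∈ Ioo (0 : ℝ) 1) ∧ Tendsto t atTop (𝓝[<] 1) ∧
      Tendsto (fun k => θ (t k)) atTop (𝓝 θ₁) := by
  have hpi := Real.pi_pos
  have hmem : ∀ᶠ t in 𝓝[<] (1 : ℝ), t ∈ Ioo (0 : ℝ) 1 := Ioo_mem_nhdsLT one_pos
  -- If |θ| tends to infinity, the intermediate value theorem makes it take every large value near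
  -- the end. Otherwise |θ| stays below some bound along a sequence, and compactness gives a limit.
  by_cases h : Tendsto (fun t => |θ t|) (𝓝[<] 1) atTop
  · exfalso
    have hev : ∀ᶠ t in 𝓝[<] (1 : ℝ), |Real.cos (μ * θ t) ^ 2 - κ| < 1 / 4 := by
      have := (Metric.tendsto_nhds.1 hκ) (1 / 4) (by norm_num)
      simpa only [Real.dist_eq] using this
    obtain ⟨a, ha, ha2⟩ := (mem_nhdsLT_iff_exists_Ioo_subset' one_pos).1 (hev.and hmem)
    have ha1 : a < 1 := ha
    have ht0 : (a + 1) / 2 ∈ Ioo a 1 := ⟨by linarith, by linarith⟩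
    have key : ∀ y ≥ |θ ((a + 1) / 2)|, |Real.cos (μ * y) ^ 2 - κ| < 1 / 4 := by
      intro y hy
      obtain ⟨t1, ⟨ht1y, -⟩, ht1⟩ := (((tendsto_atTop.1 h y).and hmem).and
        (Ioo_mem_nhdsLT ht0.2)).exists
      have hsub : Icc ((a + 1) / 2) t1 ⊆ Ioo a 1 := fun s hs =>
        ⟨ht0.1.trans_le hs.1, hs.2.trans_lt ht1.2⟩
      have hc : ContinuousOn (fun t => |θ t|) (Icc ((a + 1) / 2) t1) :=
        (hθ.mono fun s hs => (ha2 (hsub hs)).2).abs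
      obtain ⟨s, hs, hsy⟩ := intermediate_value_Icc ht1.1.le hc ⟨hy, ht1y⟩
      have hs1 := (ha2 (hsub hs)).1
      have hab : Real.cos (μ * y) = Real.cos (μ * θ s) := by
        simp only at hsy
        rw [← hsy, ← Real.cos_abs (μ * θ s), abs_mul, abs_of_pos hμ]
      rwa [hab]
    obtain ⟨n, hn⟩ := exists_nat_ge (μ * |θ ((a + 1) / 2)| / Real.pi)
    rw [div_le_iff₀ hpi] at hn
    have hsin := Real.sin_nat_mul_pi n
    -- At these two large values cos² is 1 and 0, which cannot both be within 1/4 of κ.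
    have e1 : μ * (n * Real.pi / μ) = n * Real.pi := by field_simp
    have e2 : μ * ((n * Real.pi + Real.pi / 2) / μ) = n * Real.pi + Real.pi / 2 := by field_simp
    have k1 := key (n * Real.pi / μ) (by rw [ge_iff_le, le_div_iff₀ hμ]; linarith)
    have k2 := key ((n * Real.pi + Real.pi / 2) / μ)
      (by rw [ge_iff_le, le_div_iff₀ hμ]; linarith)
    rw [e1, Real.cos_sq', hsin, abs_lt] at k1
    rw [e2, Real.cos_add_pi_div_two, hsin, abs_lt] at k2
    linarith [k1.2, k2.1]
  · rw [tendsto_atTop] at h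
    push Not at h
    obtain ⟨B, hB⟩ := h
    obtain ⟨t, ht, htB⟩ := exists_seq_forall_of_frequently (hB.and_eventually hmem)
    obtain ⟨θ₁, -, φ, hφ, hlim⟩ := isCompact_Icc.tendsto_subseq (x := fun k => θ (t k))
      (s := Icc (-B) B) fun k => abs_le.1 (htB k).1.le
    exact ⟨t ∘ φ, θ₁, fun k => (htB _).2, ht.comp hφ.tendsto_atTop, hlim⟩

theorem arcProper_seExtension {μ : ℝ} (hμ : 0 < μ) (hμ1 : μ ≠ 1) :
    ArcProper 0 deSitter (seExtension μ) := by
  have hcont : Continuous (seExtension μ) :=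
    (continuousOn_univ.1 (analyticOnNhd_seAmbient μ).continuousOn).comp continuous_subtype_val
  refine ⟨hcont, seExtension_mem hμ, ?_⟩
  rintro σ hσ ⟨Γ, hΓ, -, hΓσ⟩
  have hΓ1 : Tendsto Γ (𝓝[<] 1) (𝓝 (Γ 1)) := by
    rw [← nhdsWithin_Ioo_eq_nhdsLT (zero_lt_one' ℝ)]
    exact (hΓ.continuousOn 1 (right_mem_Icc.2 zero_le_one)).mono_left
      (nhdsWithin_mono _ Ioo_subset_Icc_self)
  have hmem : ∀ᶠ t in 𝓝[<] (1 : ℝ), t ∈ Ioo (0 : ℝ) 1 := Ioo_mem_nhdsLT one_pos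
  have hξ : Tendsto (fun t => (σ t).1 0) (𝓝[<] 1) (𝓝 (Γ 1 0 + Γ 1 3)) := by
    refine ((tendsto_pi_nhds.1 hΓ1 0).add (tendsto_pi_nhds.1 hΓ1 3)).congr' ?_
    filter_upwards [hmem] with t ht
    simp only [hΓσ t (Ioo_subset_Ico_self ht), seExtension, Matrix.cons_val]
    ring
  have hη : Tendsto (fun t => (σ t).1 1) (𝓝[<] 1) (𝓝 (Γ 1 0 - Γ 1 3)) := by
    refine ((tendsto_pi_nhds.1 hΓ1 0).sub (tendsto_pi_nhds.1 hΓ1 3)).congr' ?_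
    filter_upwards [hmem] with t ht
    simp only [hΓσ t (Ioo_subset_Ico_self ht), seExtension, Matrix.cons_val]
    ring
  have hc := seConst_ne_zero hμ hμ1
  have hcos : Tendsto (fun t => Real.cos (μ * (σ t).1 2) ^ 2) (𝓝[<] 1)
      (𝓝 ((Γ 1 0 + Γ 1 3) * (Γ 1 0 - Γ 1 3) / seConst μ ^ 2)) := by
    refine ((hξ.mul hη).div_const _).congr fun t => ?_
    rw [mem_seSurface.1 (σ t).2]
    field_simp
  obtain ⟨t, θ₁, ht, ht1, hlim⟩ := exists_tendsto_of_tendsto_cos_sq hμ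
    ((continuous_seSurface_apply 2).comp_continuousOn (hσ.mono Ioo_subset_Ico_self)) hcos
  -- ξ and η converge along the whole arc; only θ needs the subsequence.
  have hl : Tendsto (fun k => (σ (t k)).1) atTop (𝓝 ![Γ 1 0 + Γ 1 3, Γ 1 0 - Γ 1 3, θ₁]) := by
    rw [tendsto_pi_nhds]
    intro i
    fin_cases i
    exacts [hξ.comp ht1, hη.comp ht1, hlim]
  have hq := (isClosed_seSurface μ).mem_of_tendsto hl (Eventually.of_forall fun k => (σ (t k)).2)
  exact ⟨t, ⟨_, hq⟩, fun k => Ioo_subset_Ico_self (ht k), ht1.mono_right nhdsWithin_le_nhds,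
    tendsto_subtype_rng.2 hl⟩

/-! ### The polar angle of the plane curve -/

/-- The constant `((μ - 1)/(μ + 1))²`. -/
noncomputable def seRatio (μ : ℝ) : ℝ := ((μ - 1) / (μ + 1)) ^ 2

/-- A continuous branch of the polar angle along the plane curve. -/
noncomputable def sePolarAngle (μ θ : ℝ) : ℝ :=
  Real.pi + (1 - μ) * θ + Real.arctan (seRatio μ * Real.sin (2 * (μ * θ)) /
    (1 + seRatio μ * Real.cos (2 * (μ * θ))))

theorem seRatio_cos_pos {μ : ℝ} (hμ : 0 < μ) (x : ℝ) : 0 < 1 + seRatio μ * Real.cos x := by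
  have h0 : 0 ≤ seRatio μ := sq_nonneg _
  have h1 : seRatio μ < 1 := by
    unfold seRatio
    rw [div_pow, div_lt_one (by positivity)]
    nlinarith
  have := Real.neg_one_le_cos x
  nlinarith

theorem exists_polar_arctan {X : ℝ} (hX : 0 < X) (Y : ℝ) :
    ∃ r : ℝ, 0 < r ∧ X = r * Real.cos (Real.arctan (Y / X)) ∧
      Y = r * Real.sin (Real.arctan (Y / X)) := by
  have h : 0 < Real.sqrt (1 + (Y / X) ^ 2) := Real.sqrt_pos.2 (by positivity)
  refine ⟨X * Real.sqrt (1 + (Y / X) ^ 2), mul_pos hX h, ?_, ?_⟩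
  · rw [Real.cos_arctan]
    field_simp
  · rw [Real.sin_arctan]
    field_simp

/-- In complex form x₁ + i x₂ = (μ + 1)²/(4μ) · e^{i(π + (1 - μ)θ)} (1 + κ e^{2iμθ}) with κ = ((μ -
1)/(μ + 1))² < 1. The last factor has positive real part, so its argument is an arctangent. -/
theorem exists_polar_seX {μ : ℝ} (hμ : 0 < μ) (θ : ℝ) :
    ∃ r : ℝ, 0 < r ∧ seX1 μ θ = r * Real.cos (sePolarAngle μ θ) ∧
      seX2 μ θ = r * Real.sin (sePolarAngle μ θ) := by
  obtain ⟨r, hr, hX, hY⟩ := exists_polar_arctan (seRatio_cos_pos hμ (2 * (μ * θ)))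
    (seRatio μ * Real.sin (2 * (μ * θ)))
  refine ⟨(μ + 1) ^ 2 / (4 * μ) * r, by positivity, ?_, ?_⟩
  all_goals
    have h2 := Real.sin_sq_add_cos_sq (μ * θ)
    have e : Real.pi + (1 - μ) * θ = θ - μ * θ + Real.pi := by ring
    have hb : (μ + 1) ^ 2 / (4 * μ) * seRatio μ = (μ - 1) ^ 2 / (4 * μ) := by
      unfold seRatio
      field_simp
    rw [sePolarAngle, e]
    set ω := Real.arctan (seRatio μ * Real.sin (2 * (μ * θ)) /
      (1 + seRatio μ * Real.cos (2 * (μ * θ))))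
    rw [Real.sin_two_mul] at hY
    rw [Real.cos_two_mul] at hX
    have hX' : (μ + 1) ^ 2 / (4 * μ) * (r * Real.cos ω) = (μ + 1) ^ 2 / (4 * μ) +
        (μ - 1) ^ 2 / (4 * μ) * (2 * Real.cos (μ * θ) ^ 2 - 1) := by
      rw [← hX, ← hb]
      ring
    have hY' : (μ + 1) ^ 2 / (4 * μ) * (r * Real.sin ω) =
        (μ - 1) ^ 2 / (4 * μ) * (2 * Real.sin (μ * θ) * Real.cos (μ * θ)) := by
      rw [← hY, ← hb]
      ring
  · have e2 : (μ + 1) ^ 2 / (4 * μ) * r * Real.cos (θ - μ * θ + Real.pi + ω) =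
        -(Real.cos (θ - μ * θ) * ((μ + 1) ^ 2 / (4 * μ) * (r * Real.cos ω)) -
          Real.sin (θ - μ * θ) * ((μ + 1) ^ 2 / (4 * μ) * (r * Real.sin ω))) := by
      rw [Real.cos_add, Real.cos_add_pi, Real.sin_add_pi]
      ring
    rw [e2, hX', hY', Real.cos_sub, Real.sin_sub, seX1]
    field_simp
    ring_nf
    have h3 : Real.sin (μ * θ) ^ 2 = 1 - Real.cos (μ * θ) ^ 2 := by linarith
    simp only [h3]
    ring
  · have e2 : (μ + 1) ^ 2 / (4 * μ) * r * Real.sin (θ - μ * θ + Real.pi + ω) =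
        -(Real.sin (θ - μ * θ) * ((μ + 1) ^ 2 / (4 * μ) * (r * Real.cos ω)) +
          Real.cos (θ - μ * θ) * ((μ + 1) ^ 2 / (4 * μ) * (r * Real.sin ω))) := by
      rw [Real.sin_add, Real.cos_add_pi, Real.sin_add_pi]
      ring
    rw [e2, hX', hY', Real.cos_sub, Real.sin_sub, seX2]
    field_simp
    ring_nf
    have h3 : Real.sin (μ * θ) ^ 2 = 1 - Real.cos (μ * θ) ^ 2 := by linarith
    simp only [h3]
    ring

theorem contDiff_sePolarAngle {μ : ℝ} (hμ : 0 < μ) {n : WithTop ℕ∞} :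
    ContDiff ℝ n (sePolarAngle μ) := by
  have hs := Real.contDiff_sin (n := n)
  have hc := Real.contDiff_cos (n := n)
  have hq : ContDiff ℝ n (fun θ => seRatio μ * Real.sin (2 * (μ * θ)) /
      (1 + seRatio μ * Real.cos (2 * (μ * θ)))) :=
    ContDiff.div (by fun_prop) (by fun_prop) fun θ => (seRatio_cos_pos hμ _).ne'
  exact ContDiff.add (by fun_prop) (Real.contDiff_arctan.comp hq)

/-- A stationary polar angle would make γ' radial, against `seX_wedge_ne_zero`. It is seen by
differentiating x₁ sin φ - x₂ cos φ = 0, where φ is the polar angle. -/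
theorem deriv_sePolarAngle_ne_zero {μ : ℝ} (hμ : 0 < μ) (hμ1 : μ ≠ 1) (θ : ℝ) :
    deriv (sePolarAngle μ) θ ≠ 0 := by
  intro h0
  have hd : HasDerivAt (sePolarAngle μ) 0 θ := by
    rw [← h0]
    exact ((contDiff_sePolarAngle hμ (n := 1)).differentiable one_ne_zero θ).hasDerivAt
  have hw := seX_wedge_ne_zero hμ hμ1 θ
  obtain ⟨r, hr, h1, h2⟩ := exists_polar_seX hμ θ
  have hz : (fun t => seX1 μ t * Real.sin (sePolarAngle μ t) -
      seX2 μ t * Real.cos (sePolarAngle μ t)) = fun _ => 0 := by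
    funext t
    obtain ⟨r, -, h1, h2⟩ := exists_polar_seX hμ t
    rw [h1, h2]
    ring
  have hd2 := ((hasDerivAt_seX1 hμ θ).mul hd.sin).sub ((hasDerivAt_seX2 hμ θ).mul hd.cos)
  have hd3 := (hd2.congr_of_eventuallyEq (f₁ := fun _ => (0 : ℝ))
    (Eventually.of_forall fun t => (congrFun hz t).symm)).unique (hasDerivAt_const θ 0)
  simp only [mul_zero, add_zero] at hd3
  apply hw
  linear_combination -r * hd3 + (seConst μ * (μ * Real.sin (μ * θ) * Real.sin θ +
    Real.cos (μ * θ) * Real.cos θ)) * h1 - (seConst μ * (μ * Real.sin (μ * θ) * Real.cos θ -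
      Real.cos (μ * θ) * Real.sin θ)) * h2

theorem surjective_of_bounded_sub_linear {f : ℝ → ℝ} (hf : Continuous f) {a B : ℝ} (ha : a ≠ 0)
    (hB : ∀ x, |f x - a * x| ≤ B) : Function.Surjective f := by
  have h1 : ∀ x, a * x - B ≤ f x := fun x => by linarith [(abs_le.1 (hB x)).1]
  have h2 : ∀ x, f x ≤ a * x + B := fun x => by linarith [(abs_le.1 (hB x)).2]
  rcases lt_or_gt_of_ne ha with h | h
  · refine hf.surjective' ?_ ?_
    · exact tendsto_atTop_mono h1
        (tendsto_atTop_add_const_right _ _ (tendsto_id.const_mul_atBot_of_neg h))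
    · exact tendsto_atBot_mono h2
        (tendsto_atBot_add_const_right _ _ (tendsto_id.const_mul_atTop_of_neg h))
  · refine hf.surjective ?_ ?_
    · exact tendsto_atTop_mono h1
        (tendsto_atTop_add_const_right _ _ (tendsto_id.const_mul_atTop h))
    · exact tendsto_atBot_mono h2
        (tendsto_atBot_add_const_right _ _ (tendsto_id.const_mul_atBot h))

/-- The polar angle is an analytic coordinate on the plane curve. -/
theorem exists_inverse_sePolarAngle {μ : ℝ} (hμ : 0 < μ) (hμ1 : μ ≠ 1) :
    ∃ κ : ℝ → ℝ, ContDiff ℝ ⊤ κ ∧ (∀ y, sePolarAngle μ (κ y) = y) ∧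
      ∀ θ, κ (sePolarAngle μ θ) = θ := by
  have hcd := contDiff_sePolarAngle hμ (n := ⊤)
  have hsd : ∀ x, HasStrictDerivAt (sePolarAngle μ) (deriv (sePolarAngle μ) x) x := fun x =>
    hcd.contDiffAt.hasStrictDerivAt (by simp)
  have hne := deriv_sePolarAngle_ne_zero hμ hμ1
  have hinj : Function.Injective (sePolarAngle μ) := by
    have : ∀ x y, x < y → sePolarAngle μ x ≠ sePolarAngle μ y := fun x y hxy h => by
      obtain ⟨c, -, hc⟩ := exists_deriv_eq_zero hxy hcd.continuous.continuousOn h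
      exact hne c hc
    intro x y h
    by_contra hxy
    rcases lt_or_gt_of_ne hxy with hlt | hgt
    exacts [this x y hlt h, this y x hgt h.symm]
  have hsurj : Function.Surjective (sePolarAngle μ) := by
    -- The angle differs from (1 - μ)θ by π plus an arctangent, and the slope 1 - μ is nonzero.
    refine surjective_of_bounded_sub_linear hcd.continuous (a := 1 - μ)
      (B := Real.pi + Real.pi / 2) (fun h => hμ1 (by linarith)) fun x => ?_
    have hpi := Real.pi_pos
    have h1 := Real.neg_pi_div_two_lt_arctan (seRatio μ * Real.sin (2 * (μ * x)) /
      (1 + seRatio μ * Real.cos (2 * (μ * x))))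
    have h2 := Real.arctan_lt_pi_div_two (seRatio μ * Real.sin (2 * (μ * x)) /
      (1 + seRatio μ * Real.cos (2 * (μ * x))))
    rw [sePolarAngle, abs_le]
    constructor <;> linarith
  let e : ℝ ≃ₜ ℝ := (Equiv.ofBijective _ ⟨hinj, hsurj⟩).toHomeomorphOfContinuousOpen
    hcd.continuous (isOpenMap_of_hasStrictDerivAt hsd hne)
  have hk : ContDiff ℝ ⊤ e.symm :=
    e.contDiff_symm_deriv hne (fun x => (hsd x).hasDerivAt) hcd
  exact ⟨e.symm, hk, fun y => e.apply_symm_apply y, fun θ => e.symm_apply_apply θ⟩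

/-! ### Analytic curves in the plane -/

/-- A nowhere vanishing analytic curve in `ℂ` has an analytic argument. -/
theorem exists_analytic_polar {a b : ℝ} (hab : a < b) {δ : ℝ → ℂ}
    (hδ : AnalyticOnNhd ℝ δ (Ioo a b)) (h0 : ∀ t ∈ Ioo a b, δ t ≠ 0) :
    ∃ f : ℝ → ℂ, AnalyticOnNhd ℝ f (Ioo a b) ∧ ∀ t ∈ Ioo a b, Complex.exp (f t) = δ t := by
  have hsc : IsSimplyConnected (Ioo a b) := by
    have : ContractibleSpace (Ioo a b) := (convex_Ioo a b).contractibleSpace (nonempty_Ioo.2 hab)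
    exact (inferInstance : SimplyConnectedSpace (Ioo a b))
  obtain ⟨f, hf, hexp⟩ := Complex.exists_continuousOn_eqOn_exp_comp hsc isOpen_Ioo
    hδ.continuousOn (by rintro ⟨t, ht, h⟩; exact h0 t ht h)
  refine ⟨f, fun t₀ ht₀ => ?_, hexp⟩
  have hmem : Ioo a b ∈ 𝓝 t₀ := isOpen_Ioo.mem_nhds ht₀
  -- The continuous logarithm f agrees near t₀ with this analytic one, as long as Im(f(t) - f(t₀))
  -- stays in (-π, π).
  have hlog : AnalyticAt ℝ (fun t => f t₀ + Complex.log (δ t / δ t₀)) t₀ := by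
    have h1 : AnalyticAt ℝ Complex.log (δ t₀ / δ t₀) := by
      rw [div_self (h0 t₀ ht₀)]
      exact (analyticAt_clog Complex.one_mem_slitPlane).restrictScalars
    exact analyticAt_const.add (h1.comp (f := fun t => δ t / δ t₀) (hδ t₀ ht₀).div_const)
  refine hlog.congr ?_
  have hc : ContinuousAt (fun t => (f t - f t₀).im) t₀ :=
    Complex.continuous_im.continuousAt.comp ((hf.continuousAt hmem).sub continuousAt_const)
  have hlt : ∀ᶠ t in 𝓝 t₀, |(f t - f t₀).im| < Real.pi := by
    refine hc.abs.eventually (gt_mem_nhds ?_)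
    simpa using Real.pi_pos
  filter_upwards [hmem, hlt] with t ht hlt
  have h1 : δ t / δ t₀ = Complex.exp (f t - f t₀) := by
    rw [Complex.exp_sub, ← hexp ht, ← hexp ht₀]
    rfl
  rw [h1, Complex.log_exp (abs_lt.1 hlt).1 (abs_lt.1 hlt).2.le]
  ring

/-- Unless f vanishes on s, its zeros there form a discrete set, and discrete subsets of ℝ are
countable. -/
theorem AnalyticOnNhd.eqOn_zero_of_not_countable {f : ℝ → ℝ} {s : Set ℝ}
    (hf : AnalyticOnNhd ℝ f s) (hs : IsPreconnected s) (h : ¬({t | f t = 0} ∩ s).Countable) :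
    EqOn f 0 s := by
  refine (hf.eqOn_zero_or_eventually_ne_zero_of_preconnected hs).resolve_right fun hne => h ?_
  have hd : IsDiscrete ({t | f t = 0} ∩ s) := isDiscrete_of_codiscreteWithin hne
  exact (HereditarilyLindelofSpace.isLindelof _).countable_of_isDiscrete hd

theorem exists_int_of_polar_eq {R r x y : ℝ} (hR : 0 < R) (hr : 0 < r)
    (hc : R * Real.cos x = r * Real.cos y) (hs : R * Real.sin x = r * Real.sin y) :
    ∃ n : ℤ, y = x + 2 * Real.pi * n := by
  have h1 := Real.sin_sq_add_cos_sq x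
  have h2 := Real.sin_sq_add_cos_sq y
  have hsq : R ^ 2 = r ^ 2 := by
    linear_combination (R * Real.cos x + r * Real.cos y) * hc +
      (R * Real.sin x + r * Real.sin y) * hs - R ^ 2 * h1 + r ^ 2 * h2
  have hRr : R = r := (pow_left_inj₀ hR.le hr.le two_ne_zero).1 hsq
  rw [hRr] at hc hs
  have hang := Real.Angle.cos_sin_inj (mul_left_cancel₀ hr.ne' hc).symm
    (mul_left_cancel₀ hr.ne' hs).symm
  obtain ⟨n, hn⟩ := Real.Angle.angle_eq_iff_two_pi_dvd_sub.1 hang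
  exact ⟨n, by linarith⟩

/-- An analytic curve that avoids the origin and starts on the plane curve lifts to it. -/
theorem exists_lift_seX {μ : ℝ} (hμ : 0 < μ) (hμ1 : μ ≠ 1) {T ε : ℝ} (hε : 0 < ε) (hεT : ε ≤ T)
    {x y : ℝ → ℝ} (hx : AnalyticOnNhd ℝ x (Ioo 0 T)) (hy : AnalyticOnNhd ℝ y (Ioo 0 T))
    (h0 : ∀ t ∈ Ioo 0 T, ¬(x t = 0 ∧ y t = 0))
    (hm : ∀ t ∈ Ioo 0 ε, ∃ θ, x t = seX1 μ θ ∧ y t = seX2 μ θ) :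
    ∃ θ : ℝ → ℝ, ContinuousOn θ (Ioo 0 T) ∧
      ∀ t ∈ Ioo 0 T, x t = seX1 μ (θ t) ∧ y t = seX2 μ (θ t) := by
  obtain ⟨κ, hκ, hκ1, hκ2⟩ := exists_inverse_sePolarAngle hμ hμ1
  have hδ : AnalyticOnNhd ℝ (fun t => (x t : ℂ) + y t * Complex.I) (Ioo 0 T) := fun t ht =>
    ((Complex.ofRealCLM.analyticAt _).comp (hx t ht)).add
      (((Complex.ofRealCLM.analyticAt _).comp (hy t ht)).mul analyticAt_const)
  obtain ⟨f, hf, hexp⟩ := exists_analytic_polar (hε.trans_le hεT) hδ fun t ht h => h0 t ht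
    ⟨by simpa using congrArg Complex.re h, by simpa using congrArg Complex.im h⟩
  have hxR : ∀ t ∈ Ioo 0 T, x t = Real.exp (f t).re * Real.cos (f t).im := fun t ht => by
    simpa [Complex.exp_re] using (congrArg Complex.re (hexp t ht)).symm
  have hyR : ∀ t ∈ Ioo 0 T, y t = Real.exp (f t).re * Real.sin (f t).im := fun t ht => by
    simpa [Complex.exp_im] using (congrArg Complex.im (hexp t ht)).symm
  -- γ(Θ n t) always has the direction of (x, y); the function g n below measures whether the
  -- lengths agree as well.
  let Θ : ℤ → ℝ → ℝ := fun n t => κ ((f t).im + 2 * Real.pi * n)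
  have hΘ : ∀ n, AnalyticOnNhd ℝ (Θ n) (Ioo 0 T) := fun n t ht =>
    (hκ.analyticAt_of_omega _).comp (f := fun t => (f t).im + 2 * Real.pi * n)
      (((Complex.imCLM.analyticAt _).comp (hf t ht)).add analyticAt_const)
  let g : ℤ → ℝ → ℝ := fun n t => x t ^ 2 + y t ^ 2 - (1 + seProd μ (Θ n t))
  have hg : ∀ n, AnalyticOnNhd ℝ (g n) (Ioo 0 T) := fun n t ht =>
    (((hx t ht).pow 2).add ((hy t ht).pow 2)).sub (analyticAt_const.add
      (((contDiff_seProd μ).analyticAt_of_omega _).comp (hΘ n t ht)))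
  have hcover : Ioo 0 ε ⊆ ⋃ n, {t | g n t = 0} ∩ Ioo 0 T := by
    intro t ht
    have htT : t ∈ Ioo 0 T := ⟨ht.1, ht.2.trans_le hεT⟩
    obtain ⟨θ, h1, h2⟩ := hm t ht
    obtain ⟨r, hr, e1, e2⟩ := exists_polar_seX hμ θ
    obtain ⟨n, hn⟩ := exists_int_of_polar_eq (Real.exp_pos _) hr
      ((hxR t htT).symm.trans (h1.trans e1)) ((hyR t htT).symm.trans (h2.trans e2))
    refine mem_iUnion.2 ⟨n, ?_, htT⟩
    have h3 := seX1_sq_add_seX2_sq hμ θ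
    have hθ : Θ n t = θ := by
      change κ ((f t).im + 2 * Real.pi * n) = θ
      rw [← hn, hκ2]
    change x t ^ 2 + y t ^ 2 - (1 + seProd μ (Θ n t)) = 0
    rw [hθ, h1, h2, h3, seProd, sub_self]
  -- The integer n may depend on t, but countably many zero sets cover the uncountable interval (0,
  -- ε).
  have hn : ∃ n, ¬({t | g n t = 0} ∩ Ioo 0 T).Countable := by
    by_contra hall
    push Not at hall
    exact (Cardinal.Real.Ioo_countable_iff.1 ((countable_iUnion hall).mono hcover)).not_gt hε
  obtain ⟨n, hn⟩ := hn
  have hz := (hg n).eqOn_zero_of_not_countable isPreconnected_Ioo hn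
  refine ⟨Θ n, (hΘ n).continuousOn, fun t ht => ?_⟩
  obtain ⟨r, hr, e1, e2⟩ := exists_polar_seX hμ (Θ n t)
  have hang : sePolarAngle μ (Θ n t) = (f t).im + n * (2 * Real.pi) := by
    change sePolarAngle μ (κ ((f t).im + 2 * Real.pi * n)) = _
    rw [hκ1]
    ring
  rw [hang, Real.cos_add_int_mul_two_pi] at e1
  rw [hang, Real.sin_add_int_mul_two_pi] at e2
  have h3 := seX1_sq_add_seX2_sq hμ (Θ n t)
  have h4 : x t ^ 2 + y t ^ 2 - (1 + seProd μ (Θ n t)) = 0 := hz ht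
  rw [seProd, ← h3, e1, e2, hxR t ht, hyR t ht] at h4
  have h5 := Real.sin_sq_add_cos_sq (f t).im
  have hsq : Real.exp (f t).re ^ 2 = r ^ 2 := by
    linear_combination h4 + (r ^ 2 - Real.exp (f t).re ^ 2) * h5
  have hRr := (pow_left_inj₀ (Real.exp_pos _).le hr.le two_ne_zero).1 hsq
  rw [e1, e2, hxR t ht, hyR t ht, hRr]
  exact ⟨rfl, rfl⟩

/-- If (x₁, x₂) = γ(θ), the de Sitter equation is precisely the surface equation for ξ = x₀ + x₃, η
= x₀ - x₃. Completeness thus becomes a question about plane curves. -/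
theorem mem_range_seExtension_iff {μ : ℝ} (hμ : 0 < μ) {x : Fin 4 → ℝ} (hx : x ∈ deSitter) :
    x ∈ range (seExtension μ) ↔ ∃ θ, x 1 = seX1 μ θ ∧ x 2 = seX2 μ θ := by
  constructor
  · rintro ⟨p, rfl⟩
    exact ⟨p.1 2, rfl, rfl⟩
  · rintro ⟨θ, h1, h2⟩
    have h3 := seX1_sq_add_seX2_sq hμ θ
    have h4 := mem_deSitter.1 hx
    refine ⟨⟨![x 0 + x 3, x 0 - x 3, θ], ?_⟩, ?_⟩
    · rw [mem_seSurface]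
      simp only [Matrix.cons_val]
      rw [h1, h2] at h4
      linarith
    · ext i
      fin_cases i <;> simp [seExtension, h1, h2]

theorem analyticallyComplete_seExtension {μ : ℝ} (hμ : 0 < μ) (hμ1 : μ ≠ 1) :
    AnalyticallyComplete deSitter (range (seExtension μ)) := by
  refine ⟨⟨_, mem_range_self ⟨_, mem_seSurface_vertex hμ⟩⟩, ?_, ?_⟩
  · rintro _ ⟨p, rfl⟩
    exact seExtension_mem hμ p
  rintro Γ hΓ hN ⟨ε, hε, hm⟩
  have hΓc : ContinuousOn Γ (Icc 0 1) := hΓ.continuousOn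
  have hcomp : ∀ i, ContinuousOn (fun t => Γ t i) (Icc 0 1) := fun i =>
    (continuous_apply i).comp_continuousOn hΓc
  have hΓo : AnalyticOnNhd ℝ Γ (Ioo 0 1) :=
    isOpen_Ioo.analyticOn_iff_analyticOnNhd.1 (hΓ.mono Ioo_subset_Icc_self)
  have han : ∀ i, AnalyticOnNhd ℝ (fun t => Γ t i) (Ioo 0 1) := fun i =>
    (analyticOnNhd_eval i univ).comp hΓo (mapsTo_univ _ _)
  have hstart : ∀ t ∈ Ico 0 ε, ∃ θ, Γ t 1 = seX1 μ θ ∧ Γ t 2 = seX2 μ θ := fun t ht =>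
    (mem_range_seExtension_iff hμ (hN ⟨ht.1, (ht.2.trans hε.2).le⟩)).1 (hm ht)
  have hone : ∀ {x y θ : ℝ}, x = seX1 μ θ ∧ y = seX2 μ θ → 1 ≤ x ^ 2 + y ^ 2 := by
    rintro x y θ ⟨rfl, rfl⟩
    rw [seX1_sq_add_seX2_sq hμ]
    linarith [seProd_nonneg μ θ, seProd.eq_1 μ θ]
  have hlift : ∀ T ≤ 1, ε ≤ T → (∀ t ∈ Ioo 0 T, ¬(Γ t 1 = 0 ∧ Γ t 2 = 0)) →
      ∃ θ : ℝ → ℝ, ContinuousOn θ (Ioo 0 T) ∧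
        ∀ t ∈ Ioo 0 T, Γ t 1 = seX1 μ (θ t) ∧ Γ t 2 = seX2 μ (θ t) := fun T hT1 hεT h =>
    exists_lift_seX hμ hμ1 hε.1 hεT ((han 1).mono (Ioo_subset_Ioo_right hT1))
      ((han 2).mono (Ioo_subset_Ioo_right hT1)) h fun t ht => hstart t (Ioo_subset_Ico_self ht)
  -- Up to a first zero T the planar part lifts to γ, so its squared length is at least 1, and by
  -- continuity also at T.
  have hnv : ∀ t ∈ Ioo (0 : ℝ) 1, ¬(Γ t 1 = 0 ∧ Γ t 2 = 0) := by
    by_contra hcon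
    push Not at hcon
    obtain ⟨t₁, ht₁, hz₁⟩ := hcon
    have hq : ContinuousOn (fun t => Γ t 1 ^ 2 + Γ t 2 ^ 2) (Icc 0 1) :=
      ((hcomp 1).pow 2).add ((hcomp 2).pow 2)
    have hclosed : IsCompact (Icc 0 t₁ ∩ {t | Γ t 1 ^ 2 + Γ t 2 ^ 2 = 0}) := by
      have hc := (hq.mono (Icc_subset_Icc_right ht₁.2.le)).preimage_isClosed_of_isClosed
        isClosed_Icc (isClosed_singleton (x := (0 : ℝ)))
      exact isCompact_Icc.of_isClosed_subset hc inter_subset_left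
    obtain ⟨T, ⟨hT, hTz⟩, hTmin⟩ := hclosed.exists_isLeast
      ⟨t₁, right_mem_Icc.2 ht₁.1.le, by simp [hz₁.1, hz₁.2]⟩
    have hTz' : Γ T 1 ^ 2 + Γ T 2 ^ 2 = 0 := hTz
    have hT1 : T < 1 := hT.2.trans_lt ht₁.2
    have hεT : ε ≤ T := by
      by_contra hlt
      obtain ⟨θ, hθ⟩ := hstart T ⟨hT.1, not_le.1 hlt⟩
      linarith [hone hθ]
    obtain ⟨θ, -, hθ⟩ := hlift T hT1.le hεT fun t ht hz =>
      (hTmin ⟨⟨ht.1.le, ht.2.le.trans hT.2⟩, by simp [hz.1, hz.2]⟩).not_gt ht.2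
    have hTpos : 0 < T := hε.1.trans_le hεT
    have hlim : Tendsto (fun t => Γ t 1 ^ 2 + Γ t 2 ^ 2) (𝓝[<] T) (𝓝 (Γ T 1 ^ 2 + Γ T 2 ^ 2)) := by
      rw [← nhdsWithin_Ioo_eq_nhdsLT hTpos]
      exact (hq T ⟨hTpos.le, hT1.le⟩).mono_left
        (nhdsWithin_mono _ fun s hs => ⟨hs.1.le, (hs.2.trans hT1).le⟩)
    have := ge_of_tendsto hlim (b := 1) (by
      filter_upwards [Ioo_mem_nhdsLT hTpos] with t ht using hone (hθ t ht))
    linarith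
  obtain ⟨θ, hθc, hθ⟩ := hlift 1 le_rfl hε.2.le hnv
  intro t ht
  rw [mem_range_seExtension_iff hμ (hN ht)]
  rcases eq_or_lt_of_le ht.1 with h0 | h0
  · exact hstart t ⟨ht.1, h0 ▸ hε.1⟩
  rcases lt_or_eq_of_le ht.2 with h1 | rfl
  · exact ⟨θ t, hθ t ⟨h0, h1⟩⟩
  have hlim : ∀ i, Tendsto (fun t => Γ t i) (𝓝[<] 1) (𝓝 (Γ 1 i)) := fun i => by
    rw [← nhdsWithin_Ioo_eq_nhdsLT (zero_lt_one' ℝ)]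
    exact (hcomp i 1 ht).mono_left (nhdsWithin_mono _ Ioo_subset_Icc_self)
  have hc := seConst_ne_zero hμ hμ1
  -- At t = 1 the lift itself need not be known to converge; convergence of cos²(μθ) yields a limit
  -- point θ₁, and continuity of γ gives γ(θ₁) as the planar endpoint.
  have hcos : Tendsto (fun t => Real.cos (μ * θ t) ^ 2) (𝓝[<] 1)
      (𝓝 ((Γ 1 1 ^ 2 + Γ 1 2 ^ 2 - 1) / seConst μ ^ 2)) := by
    refine (((((hlim 1).pow 2).add ((hlim 2).pow 2)).sub_const 1).div_const _).congr' ?_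
    filter_upwards [Ioo_mem_nhdsLT one_pos] with t ht
    rw [(hθ t ht).1, (hθ t ht).2, seX1_sq_add_seX2_sq hμ]
    field_simp
    ring
  obtain ⟨t, θ₁, htI, ht1, hθ₁⟩ := exists_tendsto_of_tendsto_cos_sq hμ hθc hcos
  refine ⟨θ₁, ?_, ?_⟩
  · exact tendsto_nhds_unique ((hlim 1).comp ht1)
      ((((contDiff_seX1 μ (n := 0)).continuous.tendsto θ₁).comp hθ₁).congr fun k =>
        (hθ _ (htI k)).1.symm)
  · exact tendsto_nhds_unique ((hlim 2).comp ht1)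
      ((((contDiff_seX2 μ (n := 0)).continuous.tendsto θ₁).comp hθ₁).congr fun k =>
        (hθ _ (htI k)).2.symm)

theorem mainTheorem8 (μ : ℝ) (hμ : 0 < μ) (hμ1 : μ ≠ 1) :
    (∃ D : DCStructure 2 (seSurface μ),
      D.IsDCImmersion 0 Set.univ (fun p : seSurface μ => (p : Fin 3 → ℝ)) ∧
      D.dcPoints = {p : seSurface μ | p.1 0 = 0 ∧ p.1 1 = 0} ∧
      D.IsSpacelikeCMC1DCImmersion (seExtension μ) ∧
      (∀ p : seSurface μ, seExtension μ p ∉ seLimitSet μ →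
        D.IsSpacelikeCMC1At (seExtension μ) p) ∧
      D.IsAnalyticExtension deSitter (seCatenoid μ) (seExtension μ)) ∧
    Set.range (seExtension μ) =
      Set.range (seCatenoid μ) ∪ seLimitSet μ ∪ seReflection '' Set.range (seCatenoid μ) ∧
    ArcProper 0 deSitter (seExtension μ) ∧
    AnalyticallyComplete deSitter (Set.range (seExtension μ)) :=
  ⟨⟨seDCStructure hμ hμ1, isDCImmersion_inclusion hμ hμ1, dcPoints_seDCStructure hμ hμ1,
    isSpacelikeCMC1DCImmersion_seExtension hμ hμ1, fun _ hp =>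
      isSpacelikeCMC1At_seExtension hμ hμ1 fun h => hp (seExtension_mem_seLimitSet hμ h),
    isAnalyticExtension_seExtension hμ hμ1⟩, range_seExtension hμ hμ1,
    arcProper_seExtension hμ hμ1, analyticallyComplete_seExtension hμ hμ1⟩
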